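/- Let $\alpha>0$, let $n$ be the integer with $n-1<\alpha\le n$, and let $g_k=(-1)^k\binom{\alpha}{k}$, the coefficients of $(1-z)^\alpha$. For $h>0$ and a real shift $r$ put $$\delta_{\mp h,r}f(x)=\frac1{h^\alpha}\sum_{k=0}^{\infty}g_k\,f\bigl(x\mp(k-r)h\bigr),$$ and let ${}_{-\infty}D_x^\alpha f(x)=\lim_{h\to0^+}\delta_{-h,0}f(x)$ and ${}_xD_\infty^\alpha f(x)=\lim_{h\to0^+}\delta_{+h,0}f(x)$ be the left and right Grünwald–Letnikov derivatives. For real $p\ne q$ put $\lambda_1=\frac{\alpha-2q}{2(p-q)}$ and $\lambda_2=\frac{2p-\alpha}{2(p-q)}$. **(1) Second order accuracy.** We have $\lambda_1+\lambda_2=1$. Let $f:\mathbb R\to\mathbb R$ be of class $C^{n+3}$ with $f^{(k)}\in L^1(\mathbb R)$ for $0\le k\le n+3$. Then all series above converge (absolutely), both fractional derivatives exist at every $x\in\mathbb R$, and, uniformly in $x\in\mathbb R$ and $0<h\le1$, $$\lambda_1\delta_{-h,p}f(x)+\lambda_2\delta_{-h,q}f(x)={}_{-\infty}D_x^\alpha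 f(x)+O(h^2),\qquad \lambda_1\delta_{+h,p}f(x)+\lambda_2\delta_{+h,q}f(x)={}_xD_\infty^\alpha f(x)+O(h^2).$$ If moreover $f=0$ on $(-\infty,a)$, then for $x>a$ the same left-hand estimate holds with the same constant when each left sum is truncated to $0\le k\le N+r$, where $N=\lfloor (x-a)/h\rfloor$ and $r$ is the shift ($r=p$ or $r=q$); and the derivative ${}_aD_x^\alpha f(x)$, defined as the limit as $h\to0^+$ of the truncated sums with shift $0$, exists and equals ${}_{-\infty}D_x^\alpha f(x)$. If $f=0$ on $(b,\infty)$, the analogous statement holds for $x<b$ on the right, with $N=\lfloor(b-x)/h\rfloor$. **(2) Generating function.** Let $W(w)=\sum_{k\ge0}g_kw^k$ and, with the principal branch of $z^\alpha$, $$G(z)=\frac{1}{z^{\alpha}}\,W(e^{-z})\,\bigl(\lambda_1e^{pz}+\lambda_2e^{qz}\bigr)\qquad(\operatorname{Re}z\ge0,\ z\ne0).$$ The series $W(e^{-z})$ converges for $\operatorname{Re} z\ge 0$ and, as $z\to0$ in $\{\operatorname{Re}z\ge0,\ z\neq0\}$, $$G(z)=1+c\,z^2+O(z^3),\qquad c=c(\alpha,p,q)=-\frac{\alpha^2}{8}+\frac{\alpha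 p}{4}+\frac{\alpha q}{4}+\frac{\alpha}{24}-\frac{pq}{2}.$$ **(3) Non-vanishing.** We have $c=0$ if and only if $3(2p-\alpha)(2q-\alpha)=\alpha$. If $0<\alpha\le2$, then $c\neq0$ for all integers $p\ne q$ except possibly when one of them is $1$ and the other is at least $2$; in particular $c\ne0$ for $(p,q)=(1,0)$ and $(p,q)=(1,-1)$. -/

import Mathlib

open Filter Topology Asymptotics

noncomputable section

/-- The Grünwald coefficients `g_k = (-1)^k * binom(α, k)`. -/
def grunwaldCoeff (α : ℝ) (k : ℕ) : ℝ := (-1) ^ k * Ring.choose α k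

/-- Left Grünwald operator with shift `r` for a function on the whole line:
`h^{-α} * ∑_{k ≥ 0} g_k f(x - (k - r) h)`. -/
def grunwaldLeft (α r h : ℝ) (f : ℝ → ℝ) (x : ℝ) : ℝ :=
  1 / h ^ α * ∑' k : ℕ, grunwaldCoeff α k * f (x - ((k : ℝ) - r) * h)

/-- Right Grünwald operator with shift `r` for a function on the whole line:
`h^{-α} * ∑_{k ≥ 0} g_k f(x + (k - r) h)`. -/
def grunwaldRight (α r h : ℝ) (f : ℝ → ℝ) (x : ℝ) : ℝ :=
  1 / h ^ α * ∑' k : ℕ, grunwaldCoeff α k * f (x + ((k : ℝ) - r) * h)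

/-- Left Grünwald operator with shift `r` and left endpoint `a`: the sum runs over the integers
`0 ≤ k ≤ N + r` with `N = ⌊(x - a) / h⌋` (it is empty if `N + r < 0`). -/
def grunwaldLeftFrom (a α r h : ℝ) (f : ℝ → ℝ) (x : ℝ) : ℝ :=
  1 / h ^ α * ∑ k ∈ Finset.range (⌊(⌊(x - a) / h⌋ : ℝ) + r⌋ + 1).toNat,
    grunwaldCoeff α k * f (x - ((k : ℝ) - r) * h)

/-- Right Grünwald operator with shift `r` and right endpoint `b`: the sum runs over the integers
`0 ≤ k ≤ N + r` with `N = ⌊(b - x) / h⌋` (it is empty if `N + r < 0`). -/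
def grunwaldRightTo (b α r h : ℝ) (f : ℝ → ℝ) (x : ℝ) : ℝ :=
  1 / h ^ α * ∑ k ∈ Finset.range (⌊(⌊(b - x) / h⌋ : ℝ) + r⌋ + 1).toNat,
    grunwaldCoeff α k * f (x + ((k : ℝ) - r) * h)

/-- `L` is the left Grünwald–Letnikov derivative of order `α` of `f` at `x`, from `-∞`. -/
def HasLeftGLDeriv (α : ℝ) (f : ℝ → ℝ) (x L : ℝ) : Prop :=
  Tendsto (fun h : ℝ => grunwaldLeft α 0 h f x) (𝓝[>] 0) (𝓝 L)

/-- `L` is the right Grünwald–Letnikov derivative of order `α` of `f` at `x`, to `+∞`. -/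
def HasRightGLDeriv (α : ℝ) (f : ℝ → ℝ) (x L : ℝ) : Prop :=
  Tendsto (fun h : ℝ => grunwaldRight α 0 h f x) (𝓝[>] 0) (𝓝 L)

/-- `L` is the left Grünwald–Letnikov derivative of order `α` of `f` at `x`, from `a`. -/
def HasLeftGLDerivFrom (a α : ℝ) (f : ℝ → ℝ) (x L : ℝ) : Prop :=
  Tendsto (fun h : ℝ => grunwaldLeftFrom a α 0 h f x) (𝓝[>] 0) (𝓝 L)

/-- `L` is the right Grünwald–Letnikov derivative of order `α` of `f` at `x`, to `b`. -/
def HasRightGLDerivTo (b α : ℝ) (f : ℝ → ℝ) (x L : ℝ) : Prop :=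
  Tendsto (fun h : ℝ => grunwaldRightTo b α 0 h f x) (𝓝[>] 0) (𝓝 L)

/-- The weight `λ₁ = (α - 2q) / (2(p - q))`. -/
def weightOne (α p q : ℝ) : ℝ := (α - 2 * q) / (2 * (p - q))

/-- The weight `λ₂ = (2p - α) / (2(p - q))`. -/
def weightTwo (α p q : ℝ) : ℝ := (2 * p - α) / (2 * (p - q))

/-- The generating function `W(w) = ∑_{k ≥ 0} g_k w^k` of the Grünwald coefficients. -/
def grunwaldGen (α : ℝ) (w : ℂ) : ℂ := ∑' k : ℕ, (grunwaldCoeff α k : ℂ) * w ^ k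

/-- `G_r(z) = z^{-α} W(e^{-z}) e^{rz}`, with the principal branch of `z^α`. -/
def grunwaldSymbol (α r : ℝ) (z : ℂ) : ℂ :=
  1 / z ^ (α : ℂ) * grunwaldGen α (Complex.exp (-z)) * Complex.exp (r * z)

/-- The coefficient `-α²/8 + αp/4 + αq/4 + α/24 - pq/2`. -/
def secondCoeff (α p q : ℝ) : ℝ :=
  -α ^ 2 / 8 + α * p / 4 + α * q / 4 + α / 24 - p * q / 2

end

/-! A shifted Grünwald operator is a Fourier multiplier. The `g_k` are absolutely summable, so
inserting Fourier inversion into the series gives the multiplier `h^{-α} W(e^{-iy}) e^{iry}` with `y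
= 2πξh`. Up to the factor `(2πiξ)^α` this is the symbol `W(e^{-z}) e^{rz} / z^α` at `z = iy`.

Since `W(w) = (1 - w)^α` on the closed unit disc (`grunwaldGen_eq`), the symbol equals `exp(α log((1
- e^{-z})/z) + rz)` near `0` in the closed right half-plane, and it expands as `1 + (r - α/2) z +
((r - α/2)²/2 + α/24) z² + O(z³)`. The weights sum to `1` and cancel the linear terms; the averaged
quadratic term is `c`.

On the imaginary axis, this expansion near `0` and boundedness far away give a global error bound `C
|y|^{α+m}`, with `m = 1` for shift `0` and `m = 2` for the weighted pair. After rescaling, the error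
is at most a constant times `h^m ∫ |f̂| |ξ|^{α+m}`. With `n + 3` integrable derivatives, `f̂ = O((1
+ |ξ|)^{-(n+3)})`, so the integral for `m = 2` converges when `α < n`. The limit is the inverse
transform of `(2πiξ)^α f̂`.

This decay is just insufficient when `α = n`. There the series is a finite difference, and Taylor's
formula together with the moments of the binomial stencil gives the same rates, with limit
`f^{(n)}`.

Truncation drops only values at points below `a + h`. If `f = 0` on `(-∞, a)`, these are
`O(h^{n+2})`, which leaves `O(h²)` after division by `h^α`. Right operators are left operators
applied to `f(-·)`. -/

/-! ### Absolute summability of the Grünwald coefficients. -/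

theorem Ring.choose_succ_mul_succ (r : ℝ) (N : ℕ) :
    Ring.choose r (N + 1) * (N + 1) = Ring.choose r N * (r - N) := by
  rw [Ring.choose_eq_smul, Ring.choose_eq_smul, descPochhammer_succ_right, Polynomial.smeval_mul,
    Nat.factorial_succ]
  simp only [Polynomial.smeval_sub, Polynomial.smeval_X, Polynomial.smeval_natCast, pow_one,
    pow_zero, smul_eq_mul, nsmul_eq_mul, mul_one]
  have : (N.factorial : ℝ) ≠ 0 := by positivity
  push_cast
  field_simp

/-- In Pascal's rule the second summand is `-c` times the first, with `c = (N + 1 - α)/(N + 1)` in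
`[0, 1]`, so absolute values subtract exactly. The resulting differences telescope. -/
theorem Ring.abs_choose_succ_eq_sub {α : ℝ} {N : ℕ} (hα : 0 < α) (h : α ≤ N + 1) :
    |Ring.choose α (N + 1)| = |Ring.choose (α - 1) N| - |Ring.choose (α - 1) (N + 1)| := by
  have h1 : Ring.choose α (N + 1) = Ring.choose (α - 1) N + Ring.choose (α - 1) (N + 1) := by
    simpa using Ring.choose_succ_succ (α - 1) N
  have hN : (0 : ℝ) < N + 1 := by positivity
  have h2 : Ring.choose (α - 1) (N + 1) = -(((N + 1 - α) / (N + 1)) * Ring.choose (α - 1) N) := by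
    have := Ring.choose_succ_mul_succ (α - 1) N
    field_simp
    linarith
  have hc : 0 ≤ (N + 1 - α) / (N + 1) := div_nonneg (by linarith) hN.le
  have hc' : (N + 1 - α) / (N + 1) ≤ 1 := by rw [div_le_one hN]; linarith
  rw [h1, h2, abs_neg, abs_mul, abs_of_nonneg hc]
  rw [show ∀ a c : ℝ, a + -(c * a) = (1 - c) * a by intros; ring, abs_mul,
    abs_of_nonneg (sub_nonneg.2 hc')]
  ring

theorem abs_grunwaldCoeff (α : ℝ) (k : ℕ) : |grunwaldCoeff α k| = |Ring.choose α k| := by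
  simp [grunwaldCoeff, abs_mul]

theorem summable_abs_grunwaldCoeff {α : ℝ} (hα : 0 < α) :
    Summable fun k => |grunwaldCoeff α k| := by
  obtain ⟨m, hm⟩ := exists_nat_ge α
  rw [← summable_nat_add_iff (m + 1)]
  -- Beyond index `m ≥ α` the sum telescopes, so every partial sum is at most its first term.
  refine summable_of_sum_range_le (c := |Ring.choose (α - 1) m|) (fun _ => abs_nonneg _) ?_
  intro K
  have : ∀ i : ℕ, |grunwaldCoeff α (i + (m + 1))| =
      |Ring.choose (α - 1) (i + m)| - |Ring.choose (α - 1) (i + 1 + m)| := by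
    intro i
    rw [abs_grunwaldCoeff, ← add_assoc, Ring.abs_choose_succ_eq_sub hα
      (by push_cast; linarith [Nat.cast_nonneg (α := ℝ) i]), add_right_comm]
  simp_rw [this]
  rw [Finset.sum_range_sub' (fun i => |Ring.choose (α - 1) (i + m)|)]
  simp

/-! ### The generating function on the closed unit disc. -/

theorem norm_grunwaldCoeff_mul_pow_le (α : ℝ) {w : ℂ} (hw : ‖w‖ ≤ 1) (k : ℕ) :
    ‖(grunwaldCoeff α k : ℂ) * w ^ k‖ ≤ |grunwaldCoeff α k| := by
  rw [norm_mul, norm_pow, Complex.norm_real, Real.norm_eq_abs]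
  exact mul_le_of_le_one_right (abs_nonneg _) (pow_le_one₀ (norm_nonneg _) hw)

theorem summable_grunwaldCoeff_mul_pow {α : ℝ} (hα : 0 < α) {w : ℂ} (hw : ‖w‖ ≤ 1) :
    Summable fun k : ℕ => (grunwaldCoeff α k : ℂ) * w ^ k :=
  .of_norm_bounded (summable_abs_grunwaldCoeff hα) (norm_grunwaldCoeff_mul_pow_le α hw)

theorem norm_grunwaldGen_le {α : ℝ} (hα : 0 < α) {w : ℂ} (hw : ‖w‖ ≤ 1) :
    ‖grunwaldGen α w‖ ≤ ∑' k, |grunwaldCoeff α k| :=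
  tsum_of_norm_bounded (summable_abs_grunwaldCoeff hα).hasSum (norm_grunwaldCoeff_mul_pow_le α hw)

theorem grunwaldGen_eq_of_norm_lt_one {α : ℝ} {w : ℂ} (hw : ‖w‖ < 1) :
    grunwaldGen α w = (1 - w) ^ (α : ℂ) := by
  have h := (Complex.one_add_cpow_hasFPowerSeriesOnBall_zero (a := (α : ℂ))).hasSum (y := -w)
    (by
      rw [Metric.mem_eball, edist_zero_right, enorm_neg, ← ofReal_norm]
      exact ENNReal.ofReal_lt_one.2 hw)
  rw [zero_add, ← sub_eq_add_neg] at h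
  rw [← h.tsum_eq]
  refine tsum_congr fun k => ?_
  rw [binomialSeries_apply]
  simp only [grunwaldCoeff, List.ofFn_const, List.prod_replicate, smul_eq_mul]
  rw [neg_pow]
  push_cast [Complex.ofReal_choose]
  ring

theorem continuousOn_grunwaldGen {α : ℝ} (hα : 0 < α) :
    ContinuousOn (grunwaldGen α) (Metric.closedBall 0 1) := by
  refine continuousOn_tsum (fun k => by fun_prop) (summable_abs_grunwaldCoeff hα) ?_
  intro k w hw
  exact norm_grunwaldCoeff_mul_pow_le α (by simpa using hw) k

/-- The binomial series gives equality in the open disc, and both sides are continuous up to the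
boundary. On the right, `1 - w` stays in the slit plane except at `w = 1`, where continuity of `z^α`
at `0` needs `α > 0`. -/
theorem grunwaldGen_eq {α : ℝ} (hα : 0 < α) {w : ℂ} (hw : ‖w‖ ≤ 1) :
    grunwaldGen α w = (1 - w) ^ (α : ℂ) := by
  have key : Set.EqOn (grunwaldGen α) (fun w => (1 - w) ^ (α : ℂ)) (Metric.closedBall 0 1) := by
    refine Set.EqOn.of_subset_closure (s := Metric.ball 0 1) ?_ (continuousOn_grunwaldGen hα) ?_
      Metric.ball_subset_closedBall (closure_ball (0 : ℂ) one_ne_zero).ge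
    · intro w hw
      exact grunwaldGen_eq_of_norm_lt_one (by simpa using hw)
    · intro w hw
      refine ContinuousAt.continuousWithinAt ?_
      rcases eq_or_ne w 1 with rfl | h1
      · have h0 : ContinuousAt (fun z : ℂ => z ^ (α : ℂ)) (1 - 1) := by
          rw [sub_self]
          exact Complex.continuousAt_cpow_zero_of_re_pos (z := (α : ℂ)) (by simpa using hα) |>.comp
            (f := fun z : ℂ => (z, (α : ℂ))) (by fun_prop)
        exact h0.comp (f := fun w : ℂ => 1 - w) (by fun_prop)
      · refine ContinuousAt.cpow (by fun_prop) continuousAt_const ?_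
        have hre : w.re ≤ 1 := (Complex.re_le_norm w).trans (by simpa using hw)
        rw [Complex.mem_slitPlane_iff]
        by_contra! hcon
        apply h1
        have him : w.im = 0 := by simpa using hcon.2
        have hre' : 1 ≤ w.re := by simpa using hcon.1
        exact Complex.ext (by simpa using le_antisymm hre hre') (by simpa using him)
  exact key (by simpa using hw)

theorem norm_exp_neg_le_one {z : ℂ} (hz : 0 ≤ z.re) : ‖Complex.exp (-z)‖ ≤ 1 := by
  rw [Complex.norm_exp]
  simpa using hz

/-! ### Expansion of the symbol at the origin. -/

theorem Asymptotics.IsBigO.of_pow_le {l : Filter ℂ} (hl : l ≤ 𝓝 0) {f : ℂ → ℂ} {m n : ℕ}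
    (h : f =O[l] fun z => z ^ n) (hmn : m ≤ n) : f =O[l] fun z => z ^ m :=
  h.trans ((IsBigO.of_bound 1 (by
    filter_upwards [hl (Metric.closedBall_mem_nhds 0 one_pos)] with z hz
    rw [norm_pow, norm_pow, one_mul]
    exact pow_le_pow_of_le_one (norm_nonneg _) (by simpa using hz) hmn)))

/-- The entire function `(1 - e^{-z}) / z`, away from its removable singularity. -/
noncomputable def oneSubExpNegDiv (z : ℂ) : ℂ := (1 - Complex.exp (-z)) / z

theorem oneSubExpNegDiv_isBigO :
    (fun z => oneSubExpNegDiv z - (1 - z / 2 + z ^ 2 / 6)) =O[𝓝[≠] 0] fun z : ℂ => z ^ 3 := by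
  have h0 : Tendsto (fun z : ℂ => -z) (𝓝[≠] 0) (𝓝 0) := by
    have : Tendsto (fun z : ℂ => -z) (𝓝 0) (𝓝 0) := by simpa using (continuous_neg (G := ℂ)).tendsto 0
    exact this.mono_left nhdsWithin_le_nhds
  have h := (Complex.exp_sub_sum_range_isBigO_pow 4).comp_tendsto h0
  have h2 := h.mul (isBigO_refl (fun z : ℂ => z⁻¹) (𝓝[≠] 0))
  refine h2.neg_left.congr' ?_ ?_
  · filter_upwards [self_mem_nhdsWithin] with z hz
    have hz : z ≠ 0 := hz
    simp only [Function.comp, Finset.sum_range_succ, Finset.sum_range_zero, oneSubExpNegDiv]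
    simp [Nat.factorial]
    field_simp
    ring
  · filter_upwards [self_mem_nhdsWithin] with z hz
    have hz : z ≠ 0 := hz
    simp only [Function.comp]
    field_simp

theorem oneSubExpNegDiv_sub_one_isBigO :
    (fun z => oneSubExpNegDiv z - 1) =O[𝓝[≠] 0] fun z : ℂ => z := by
  have h1 := oneSubExpNegDiv_isBigO.of_pow_le nhdsWithin_le_nhds (m := 1) (by norm_num)
  have h2 : (fun z : ℂ => -z / 2) =O[𝓝[≠] 0] fun z : ℂ => z ^ 1 := by
    simpa [div_eq_inv_mul] using (isBigO_refl (fun z : ℂ => z) (𝓝[≠] 0)).const_mul_left (-2⁻¹)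
  have h3 : (fun z : ℂ => z ^ 2 / 6) =O[𝓝[≠] 0] fun z : ℂ => z ^ 1 := by
    refine IsBigO.of_pow_le nhdsWithin_le_nhds (n := 2) ?_ (by norm_num)
    simpa [div_eq_inv_mul] using (isBigO_refl (fun z : ℂ => z ^ 2) (𝓝[≠] 0)).const_mul_left (6⁻¹)
  simpa using ((h1.add h2).add h3).congr_left fun z => by ring

theorem tendsto_oneSubExpNegDiv : Tendsto oneSubExpNegDiv (𝓝[≠] 0) (𝓝 1) := by
  have h : Tendsto (fun z => oneSubExpNegDiv z - 1) (𝓝[≠] 0) (𝓝 0) :=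
    oneSubExpNegDiv_sub_one_isBigO.trans_tendsto (tendsto_id.mono_left nhdsWithin_le_nhds)
  simpa using h.add_const 1

theorem log_oneSubExpNegDiv_isBigO :
    (fun z => Complex.log (oneSubExpNegDiv z) - (-z / 2 + z ^ 2 / 24)) =O[𝓝[≠] 0]
      fun z : ℂ => z ^ 3 := by
  set v : ℂ → ℂ := fun z => oneSubExpNegDiv z - 1 with hv
  have hv0 : Tendsto v (𝓝[≠] 0) (𝓝 0) := by simpa using tendsto_oneSubExpNegDiv.sub_const 1
  have hv1 : v =O[𝓝[≠] 0] fun z : ℂ => z := oneSubExpNegDiv_sub_one_isBigO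
  have hv3 := oneSubExpNegDiv_isBigO
  have hlog : (fun z => Complex.log (1 + v z) - (v z - v z ^ 2 / 2)) =O[𝓝[≠] 0]
      fun z : ℂ => z ^ 3 := by
    have := (Complex.log_sub_logTaylor_isBigO 2).comp_tendsto hv0
    refine (this.congr_left ?_).trans (hv1.pow 3)
    intro z
    simp [Complex.logTaylor_succ, Complex.logTaylor_zero]
    ring
  have hz2 : (fun z : ℂ => z ^ 2 / 6) =O[𝓝[≠] 0] fun z : ℂ => z ^ 2 := by
    simpa [div_eq_inv_mul] using (isBigO_refl (fun z : ℂ => z ^ 2) (𝓝[≠] 0)).const_mul_left (6⁻¹)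
  have hz1 : (fun z : ℂ => z / 2) =O[𝓝[≠] 0] fun z : ℂ => z := by
    simpa [div_eq_inv_mul] using (isBigO_refl (fun z : ℂ => z) (𝓝[≠] 0)).const_mul_left (2⁻¹)
  have hv2 : (fun z => v z + z / 2) =O[𝓝[≠] 0] fun z : ℂ => z ^ 2 :=
    ((hv3.of_pow_le nhdsWithin_le_nhds (m := 2) (by norm_num)).add hz2).congr_left fun z => by
      simp only [hv]; ring
  -- This product is `v² - z²/4`, so `v²/2` may be replaced by `z²/8`; then `1/6 - 1/8 = 1/24`.
  have hsq : (fun z => (v z + z / 2) * (v z - z / 2)) =O[𝓝[≠] 0] fun z : ℂ => z ^ 3 :=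
    (hv2.mul (hv1.sub hz1)).congr_right fun z => by ring
  refine ((hlog.add hv3).sub (hsq.const_mul_left (1 / 2))).congr_left fun z => ?_
  simp only [hv]
  ring_nf

theorem exp_add_mul_isBigO (α r : ℝ) :
    (fun z => Complex.exp (α * Complex.log (oneSubExpNegDiv z) + r * z) -
      (1 + (r - α / 2) * z + ((r - α / 2) ^ 2 / 2 + α / 24) * z ^ 2)) =O[𝓝[≠] 0]
      fun z : ℂ => z ^ 3 := by
  set E : ℂ → ℂ := fun z => α * Complex.log (oneSubExpNegDiv z) + r * z with hE
  have hE3 : (fun z => E z - ((r - α / 2) * z + α / 24 * z ^ 2)) =O[𝓝[≠] 0]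
      fun z : ℂ => z ^ 3 :=
    (log_oneSubExpNegDiv_isBigO.const_mul_left (α : ℂ)).congr_left fun z => by
      simp only [hE]; ring
  have hz2 : (fun z : ℂ => (α / 24 : ℂ) * z ^ 2) =O[𝓝[≠] 0] fun z : ℂ => z ^ 2 :=
    (isBigO_refl _ _).const_mul_left _
  have hz1 : (fun z : ℂ => (r - α / 2 : ℂ) * z) =O[𝓝[≠] 0] fun z : ℂ => z :=
    (isBigO_refl _ _).const_mul_left _
  have hE2 : (fun z => E z - (r - α / 2) * z) =O[𝓝[≠] 0] fun z : ℂ => z ^ 2 :=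
    ((hE3.of_pow_le nhdsWithin_le_nhds (m := 2) (by norm_num)).add hz2).congr_left fun z => by ring
  have hE1 : E =O[𝓝[≠] 0] fun z : ℂ => z := by
    have := hE2.of_pow_le nhdsWithin_le_nhds (m := 1) (by norm_num)
    simp only [pow_one] at this
    exact (this.add hz1).congr_left fun z => by ring
  have hE0 : Tendsto E (𝓝[≠] 0) (𝓝 0) :=
    hE1.trans_tendsto (tendsto_id.mono_left nhdsWithin_le_nhds)
  have hexp : (fun z => Complex.exp (E z) - (1 + E z + E z ^ 2 / 2)) =O[𝓝[≠] 0]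
      fun z : ℂ => z ^ 3 := by
    have := (Complex.exp_sub_sum_range_isBigO_pow 3).comp_tendsto hE0
    refine (this.congr_left ?_).trans (hE1.pow 3)
    intro z
    simp [Finset.sum_range_succ, Nat.factorial]
  have hsq : (fun z => (E z - (r - α / 2) * z) * (E z + (r - α / 2) * z)) =O[𝓝[≠] 0]
      fun z : ℂ => z ^ 3 :=
    (hE2.mul (hE1.add hz1)).congr_right fun z => by ring
  refine ((hexp.add hE3).add (hsq.const_mul_left (1 / 2))).congr_left fun z => ?_
  ring

/-- Write `1 - e^{-z} = z u` with `u` near `1`. Then `|arg z| ≤ π/2` and `|arg u| < π/2`, so the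
principal logarithm of the product splits with no `2πi` correction and `z^α` cancels. -/
theorem grunwaldSymbol_eventuallyEq {α : ℝ} (hα : 0 < α) (r : ℝ) :
    grunwaldSymbol α r =ᶠ[𝓝[{z : ℂ | 0 ≤ z.re ∧ z ≠ 0}] 0]
      fun z => Complex.exp (α * Complex.log (oneSubExpNegDiv z) + r * z) := by
  have hle : 𝓝[{z : ℂ | 0 ≤ z.re ∧ z ≠ 0}] (0 : ℂ) ≤ 𝓝[≠] 0 :=
    nhdsWithin_mono _ fun z hz => hz.2
  have hre : ∀ᶠ u : ℂ in 𝓝 1, 0 < u.re :=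
    (Complex.continuous_re.tendsto 1).eventually (lt_mem_nhds (by simp))
  filter_upwards [(tendsto_oneSubExpNegDiv.mono_left hle).eventually hre, self_mem_nhdsWithin]
    with z hu ⟨hz, hz0⟩
  set u := oneSubExpNegDiv z with hudef
  have hu0 : u ≠ 0 := by rintro h; simp [h] at hu
  have hzu : 1 - Complex.exp (-z) = z * u := by
    rw [hudef, oneSubExpNegDiv]; field_simp
  have harg : z.arg + u.arg ∈ Set.Ioc (-Real.pi) Real.pi := by
    have h1 := abs_le.1 (Complex.abs_arg_le_pi_div_two_iff.2 hz)
    have h2 := abs_lt.1 (Complex.abs_arg_lt_pi_div_two_iff.2 (Or.inl hu))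
    constructor <;> linarith [h1.1, h1.2, h2.1, h2.2]
  rw [grunwaldSymbol, grunwaldGen_eq hα (norm_exp_neg_le_one hz), hzu,
    Complex.cpow_def_of_ne_zero (mul_ne_zero hz0 hu0), Complex.cpow_def_of_ne_zero hz0,
    (Complex.log_mul_eq_add_log_iff hz0 hu0).2 harg, one_div, ← Complex.exp_neg,
    ← Complex.exp_add, ← Complex.exp_add]
  congr 1
  ring

theorem grunwaldSymbol_isBigO {α : ℝ} (hα : 0 < α) (r : ℝ) :
    (fun z => grunwaldSymbol α r z -
      (1 + (r - α / 2) * z + ((r - α / 2) ^ 2 / 2 + α / 24) * z ^ 2))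
      =O[𝓝[{z : ℂ | 0 ≤ z.re ∧ z ≠ 0}] 0] fun z : ℂ => z ^ 3 := by
  refine ((exp_add_mul_isBigO α r).mono (nhdsWithin_mono _ fun z hz => hz.2)).congr' ?_ .rfl
  filter_upwards [grunwaldSymbol_eventuallyEq hα r] with z hz
  rw [hz]

/-! ### The weights and the second coefficient. -/

theorem weightOne_add_weightTwo {α p q : ℝ} (hpq : p ≠ q) :
    weightOne α p q + weightTwo α p q = 1 := by
  have : p - q ≠ 0 := sub_ne_zero.2 hpq
  rw [weightOne, weightTwo]
  field_simp
  ring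

theorem weightOne_mul_add_weightTwo_mul {α p q : ℝ} (hpq : p ≠ q) :
    weightOne α p q * (p - α / 2) + weightTwo α p q * (q - α / 2) = 0 := by
  have : p - q ≠ 0 := sub_ne_zero.2 hpq
  rw [weightOne, weightTwo]
  field_simp
  ring

theorem weightOne_mul_sq_add_weightTwo_mul_sq {α p q : ℝ} (hpq : p ≠ q) :
    weightOne α p q * ((p - α / 2) ^ 2 / 2 + α / 24) +
      weightTwo α p q * ((q - α / 2) ^ 2 / 2 + α / 24) = secondCoeff α p q := by
  have : p - q ≠ 0 := sub_ne_zero.2 hpq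
  rw [weightOne, weightTwo, secondCoeff]
  field_simp
  ring

theorem weighted_grunwaldSymbol_isBigO {α p q : ℝ} (hα : 0 < α) (hpq : p ≠ q) :
    (fun z : ℂ => weightOne α p q * grunwaldSymbol α p z + weightTwo α p q * grunwaldSymbol α q z
        - (1 + secondCoeff α p q * z ^ 2))
      =O[𝓝[{z : ℂ | 0 ≤ z.re ∧ z ≠ 0}] 0] (fun z : ℂ => z ^ 3) := by
  refine (((grunwaldSymbol_isBigO hα p).const_mul_left (weightOne α p q : ℂ)).add
    ((grunwaldSymbol_isBigO hα q).const_mul_left (weightTwo α p q : ℂ))).congr_left fun z => ?_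
  have h0 : (weightOne α p q + weightTwo α p q : ℂ) = 1 := by
    exact_mod_cast weightOne_add_weightTwo hpq
  have h1 : (weightOne α p q * (p - α / 2) + weightTwo α p q * (q - α / 2) : ℂ) = 0 := by
    exact_mod_cast weightOne_mul_add_weightTwo_mul hpq
  have h2 : (weightOne α p q * ((p - α / 2) ^ 2 / 2 + α / 24) +
      weightTwo α p q * ((q - α / 2) ^ 2 / 2 + α / 24) : ℂ) = secondCoeff α p q := by
    exact_mod_cast weightOne_mul_sq_add_weightTwo_mul_sq hpq
  linear_combination -h0 - z * h1 - z ^ 2 * h2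

theorem secondCoeff_eq_zero_iff (α p q : ℝ) :
    secondCoeff α p q = 0 ↔ 3 * (2 * p - α) * (2 * q - α) = α := by
  rw [secondCoeff]
  constructor <;> intro h <;> linarith

theorem secondCoeff_ne_zero {α : ℝ} (hα : 0 < α) (hα2 : α ≤ 2) {p q : ℤ} (hpq : p ≠ q)
    (h1 : ¬ (p = 1 ∧ 2 ≤ q)) (h2 : ¬ (q = 1 ∧ 2 ≤ p)) : secondCoeff α p q ≠ 0 := by
  rw [Ne, secondCoeff_eq_zero_iff]
  wlog hlt : p < q generalizing p q
  · intro h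
    exact this hpq.symm h2 h1 (lt_of_le_of_ne (not_lt.1 hlt) hpq.symm) (by linarith)
  intro h
  -- With `p < q`: if `p ≤ 0`, both factors must be negative, so `p ≤ -1` and `q ≤ 0`, and the left
  -- side is at least `3(α + 2)α > α`. If `p ≥ 1`, the excluded case leaves `p ≥ 2`, `q ≥ 3`, so
  -- both factors are at least `2` and the left side exceeds `2 ≥ α`.
  rcases le_or_gt p 0 with hp | hp
  · have hp' : (p : ℝ) ≤ 0 := by exact_mod_cast hp
    have hA : 2 * (p : ℝ) - α < 0 := by linarith
    have hB : 2 * (q : ℝ) - α < 0 := by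
      by_contra! hB
      nlinarith [mul_nonneg hB (neg_nonneg.2 hA.le)]
    have hq : q < 1 := by
      have : (q : ℝ) < 1 := by linarith
      exact_mod_cast this
    have hp1 : (p : ℝ) ≤ -1 := by exact_mod_cast (show p ≤ -1 by omega)
    have hq0 : (q : ℝ) ≤ 0 := by exact_mod_cast (show q ≤ 0 by omega)
    nlinarith [mul_nonneg (show 0 ≤ α - 2 * (p : ℝ) - 2 by linarith)
      (show 0 ≤ α - 2 * (q : ℝ) by linarith)]
  · have hp2 : (2 : ℝ) ≤ p := by exact_mod_cast (show 2 ≤ p by omega)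
    have hq3 : (3 : ℝ) ≤ q := by exact_mod_cast (show 3 ≤ q by omega)
    nlinarith [mul_nonneg (show 0 ≤ 2 * (p : ℝ) - α - 2 by linarith)
      (show 0 ≤ 2 * (q : ℝ) - α - 2 by linarith)]

/-! ### Bounded derivatives and Taylor estimates. -/

theorem exists_forall_abs_le_of_integrable_deriv {g : ℝ → ℝ} (hg : ContDiff ℝ 1 g)
    (hi : MeasureTheory.Integrable (deriv g)) : ∃ M, ∀ x, |g x| ≤ M := by
  refine ⟨|g 0| + ∫ t, ‖deriv g t‖, fun x => ?_⟩
  have h1 : ∫ t in (0 : ℝ)..x, deriv g t = g x - g 0 :=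
    intervalIntegral.integral_eq_sub_of_hasDerivAt
      (fun t _ => (hg.differentiable one_ne_zero t).hasDerivAt) hi.intervalIntegrable
  have h2 : |g x - g 0| ≤ ∫ t, ‖deriv g t‖ := by
    rw [← h1, ← Real.norm_eq_abs]
    refine intervalIntegral.norm_integral_le_integral_norm_uIoc.trans ?_
    exact MeasureTheory.setIntegral_le_integral hi.norm (MeasureTheory.ae_of_all _ fun _ => norm_nonneg _)
  have := abs_add_le (g 0) (g x - g 0)
  rw [add_sub_cancel] at this
  linarith

theorem exists_forall_abs_iteratedDeriv_le {N : ℕ} {f : ℝ → ℝ}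
    (hf : ContDiff ℝ (N : WithTop ℕ∞) f)
    (hi : ∀ k ≤ N, MeasureTheory.Integrable (iteratedDeriv k f)) {k : ℕ} (hk : k < N) :
    ∃ M, ∀ x, |iteratedDeriv k f x| ≤ M := by
  refine exists_forall_abs_le_of_integrable_deriv ?_ ?_
  · rw [iteratedDeriv_eq_iterate]
    refine ContDiff.iterate_deriv' 1 k (hf.of_le ?_)
    exact_mod_cast (by omega : 1 + k ≤ N)
  · rw [← iteratedDeriv_succ]
    exact hi _ hk

/-- The derivative in `t` of the remainder is the lower-order remainder for `deriv f`, so the mean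
value inequality drives the induction. It costs the factor `1/m!`, which is not needed. -/
theorem abs_sub_taylor_sum_le {M : ℝ} (x : ℝ) (m : ℕ) {f : ℝ → ℝ}
    (hf : ContDiff ℝ (m : WithTop ℕ∞) f) (hM : ∀ y, |iteratedDeriv m f y| ≤ M) (t : ℝ) :
    |f (x + t) - ∑ j ∈ Finset.range m, t ^ j / j.factorial * iteratedDeriv j f x| ≤
      M * |t| ^ m := by
  have hM0 : 0 ≤ M := (abs_nonneg _).trans (hM 0)
  induction m generalizing f t with
  | zero => simpa using hM (x + t)
  | succ m ih =>
    have hf' : ContDiff ℝ (m : WithTop ℕ∞) (deriv f) :=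
      (contDiff_succ_iff_deriv (n := (m : WithTop ℕ∞)).1 (by exact_mod_cast hf)).2.2
    have hM' : ∀ y, |iteratedDeriv m (deriv f) y| ≤ M := fun y => by
      rw [← iteratedDeriv_succ']; exact hM y
    have hd : Differentiable ℝ f := hf.differentiable (by simp)
    set g : ℝ → ℝ := fun s =>
      f (x + s) - ∑ j ∈ Finset.range (m + 1), s ^ j / j.factorial * iteratedDeriv j f x with hg
    have hgd : ∀ s, HasDerivAt g (deriv f (x + s) -
        ∑ j ∈ Finset.range m, s ^ j / j.factorial * iteratedDeriv j (deriv f) x) s := by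
      intro s
      have h1 : HasDerivAt (fun s => f (x + s)) (deriv f (x + s)) s :=
        (hd (x + s)).hasDerivAt.comp_const_add x s
      refine h1.sub ?_
      have h2 : HasDerivAt (fun s : ℝ => ∑ j ∈ Finset.range (m + 1),
          s ^ j / j.factorial * iteratedDeriv j f x)
          (∑ j ∈ Finset.range (m + 1), (j * s ^ (j - 1)) / j.factorial * iteratedDeriv j f x) s :=
        HasDerivAt.fun_sum fun j _ => ((hasDerivAt_pow j s).div_const _).mul_const _
      refine h2.congr_deriv ?_
      rw [Finset.sum_range_succ']
      simp only [Nat.cast_zero, zero_mul, zero_div, add_zero]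
      refine Finset.sum_congr rfl fun j _ => ?_
      rw [← iteratedDeriv_succ', Nat.factorial_succ]
      have : (j.factorial : ℝ) ≠ 0 := by positivity
      push_cast
      field_simp
    have hg0 : g 0 = 0 := by
      simp [hg, Finset.sum_range_succ']
    have := Convex.norm_image_sub_le_of_norm_deriv_le (f := g) (C := M * |t| ^ m)
      (s := Set.uIcc 0 t) (fun s _ => (hgd s).differentiableAt) (fun s hs => by
        rw [(hgd s).deriv, Real.norm_eq_abs]
        refine (ih hf' hM' s).trans ?_
        have : |s| ≤ |t| := by simpa using Set.abs_sub_left_of_mem_uIcc hs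
        gcongr) (convex_uIcc 0 t) Set.left_mem_uIcc Set.right_mem_uIcc
    rw [hg0, sub_zero, sub_zero, Real.norm_eq_abs, Real.norm_eq_abs] at this
    rw [pow_succ, ← mul_assoc]
    exact this

theorem iteratedDeriv_eq_zero_of_eq_zero_of_lt {m j : ℕ} {f : ℝ → ℝ} {a : ℝ}
    (hf : ContDiff ℝ (m : WithTop ℕ∞) f) (hj : j ≤ m) (h0 : ∀ y < a, f y = 0) :
    iteratedDeriv j f a = 0 := by
  have hc : Continuous (iteratedDeriv j f) := hf.continuous_iteratedDeriv j (by exact_mod_cast hj)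
  have hz : Set.Iio a ⊆ iteratedDeriv j f ⁻¹' {0} := by
    intro y hy
    have : f =ᶠ[𝓝 y] fun _ => 0 := by
      filter_upwards [Iio_mem_nhds hy] with z hz using h0 z hz
    simpa using this.iteratedDeriv_eq j
  have := closure_minimal hz (isClosed_singleton.preimage hc)
  rw [closure_Iio] at this
  exact this (Set.mem_Iic.2 le_rfl)

theorem abs_le_of_eq_zero_of_lt {M a : ℝ} {m : ℕ} {f : ℝ → ℝ}
    (hf : ContDiff ℝ (m : WithTop ℕ∞) f) (hM : ∀ y, |iteratedDeriv m f y| ≤ M)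
    (h0 : ∀ y < a, f y = 0) (y : ℝ) : |f y| ≤ M * |y - a| ^ m := by
  have := abs_sub_taylor_sum_le a m hf hM (y - a)
  rwa [Finset.sum_eq_zero, sub_zero, add_sub_cancel] at this
  intro j hj
  rw [iteratedDeriv_eq_zero_of_eq_zero_of_lt hf (Finset.mem_range.1 hj).le h0, mul_zero]

/-! ### Integer order: moments of finite-difference stencils. -/

/-- Expanding each value at `x`, the moment conditions `hc` leave only the `n`-th Taylor term; the
remainders add up to the right-hand side. -/
theorem abs_sum_sub_iteratedDeriv_le {ι : Type*} (s : Finset ι) (c τ : ι → ℝ) {n m : ℕ}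
    (hnm : n < m) (hc : ∀ j < m, ∑ i ∈ s, c i * τ i ^ j = if j = n then (n.factorial : ℝ) else 0)
    {M : ℝ} {f : ℝ → ℝ} (hf : ContDiff ℝ (m : WithTop ℕ∞) f)
    (hM : ∀ y, |iteratedDeriv m f y| ≤ M) (x h : ℝ) :
    |∑ i ∈ s, c i * f (x + τ i * h) - h ^ n * iteratedDeriv n f x| ≤
      (∑ i ∈ s, |c i| * |τ i| ^ m) * M * |h| ^ m := by
  have key : ∑ i ∈ s, c i * ∑ j ∈ Finset.range m,
      (τ i * h) ^ j / j.factorial * iteratedDeriv j f x = h ^ n * iteratedDeriv n f x := by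
    simp_rw [Finset.mul_sum]
    rw [Finset.sum_comm]
    have : ∀ j ∈ Finset.range m, ∑ i ∈ s, c i *
        ((τ i * h) ^ j / j.factorial * iteratedDeriv j f x) =
        if j = n then h ^ n * iteratedDeriv n f x else 0 := by
      intro j hj
      have : ∀ i, c i * ((τ i * h) ^ j / j.factorial * iteratedDeriv j f x) =
          (c i * τ i ^ j) * (h ^ j / j.factorial * iteratedDeriv j f x) := by
        intro i; rw [mul_pow]; ring
      simp_rw [this]
      rw [← Finset.sum_mul, hc j (Finset.mem_range.1 hj)]
      split_ifs with hjn
      · subst hjn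
        have : (j.factorial : ℝ) ≠ 0 := by positivity
        field_simp
      · simp
    rw [Finset.sum_congr rfl this]
    simp [hnm]
  rw [← key, ← Finset.sum_sub_distrib, Finset.sum_mul, Finset.sum_mul]
  refine (Finset.abs_sum_le_sum_abs _ _).trans (Finset.sum_le_sum fun i _ => ?_)
  rw [← mul_sub, abs_mul, mul_assoc, mul_assoc]
  refine mul_le_mul_of_nonneg_left ?_ (abs_nonneg _)
  have := abs_sub_taylor_sum_le x m hf hM (τ i * h)
  rw [abs_mul, mul_pow] at this
  linarith

theorem grunwaldCoeff_natCast (n k : ℕ) : grunwaldCoeff n k = (-1) ^ k * (n.choose k : ℝ) := by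
  rw [grunwaldCoeff, Ring.choose_natCast]

theorem sum_grunwaldCoeff_mul_pow_eq_fwdDiff (n j : ℕ) (r : ℝ) :
    ∑ k ∈ Finset.range (n + 1), grunwaldCoeff n k * (r - k) ^ j =
      (fwdDiff 1)^[n] (fun x : ℝ => x ^ j) (r - n) := by
  rw [fwdDiff_iter_eq_sum_shift, ← Finset.sum_flip]
  refine Finset.sum_congr rfl fun k hk => ?_
  have hk : k ≤ n := by simpa [Nat.lt_succ_iff] using hk
  rw [grunwaldCoeff_natCast, Nat.choose_symm hk, Nat.cast_sub hk]
  simp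
  left
  ring

theorem sum_grunwaldCoeff_mul_pow_of_lt {n j : ℕ} (hj : j < n) (r : ℝ) :
    ∑ k ∈ Finset.range (n + 1), grunwaldCoeff n k * (r - k) ^ j = 0 := by
  rw [sum_grunwaldCoeff_mul_pow_eq_fwdDiff, fwdDiff_iter_pow_eq_zero_of_lt hj, Pi.zero_apply]

theorem sum_grunwaldCoeff_mul_pow_self (n : ℕ) (r : ℝ) :
    ∑ k ∈ Finset.range (n + 1), grunwaldCoeff n k * (r - k) ^ n = n.factorial := by
  rw [sum_grunwaldCoeff_mul_pow_eq_fwdDiff, fwdDiff_iter_eq_factorial]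
  simp

/-- The reflection `k ↦ n - k` changes the coefficient by `(-1)^n` and the power by `(-1)^{n+1}`, so
the sum equals its own negative. -/
theorem sum_grunwaldCoeff_mul_half_pow_succ (n : ℕ) :
    ∑ k ∈ Finset.range (n + 1), grunwaldCoeff n k * ((n : ℝ) / 2 - k) ^ (n + 1) = 0 := by
  have h : ∑ k ∈ Finset.range (n + 1), grunwaldCoeff n k * ((n : ℝ) / 2 - k) ^ (n + 1) =
      -∑ k ∈ Finset.range (n + 1), grunwaldCoeff n k * ((n : ℝ) / 2 - k) ^ (n + 1) := by
    conv_lhs => rw [← Finset.sum_flip]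
    rw [← Finset.sum_neg_distrib]
    refine Finset.sum_congr rfl fun k hk => ?_
    have hk : k ≤ n := by simpa [Nat.lt_succ_iff] using hk
    rw [grunwaldCoeff_natCast, grunwaldCoeff_natCast, Nat.choose_symm hk, Nat.cast_sub hk,
      show (n : ℝ) / 2 - (n - k) = -(n / 2 - k) by ring, neg_pow ((n : ℝ) / 2 - k)]
    have : (-1 : ℝ) ^ (n - k) * (-1) ^ (n + 1) = -(-1) ^ k := by
      rw [← pow_add, show n - k + (n + 1) = 2 * (n - k) + (k + 1) by omega, pow_add, pow_mul]
      simp [pow_succ]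
    linear_combination ((n.choose k : ℝ) * ((n : ℝ) / 2 - k) ^ (n + 1)) * this
  linarith

/-- The derivative in `r` is `n + 1` times the `n`-th moment, hence constant, and the sum vanishes
at the centre `r = n/2`. This is the moment that the weights cancel. -/
theorem sum_grunwaldCoeff_mul_pow_succ (n : ℕ) (r : ℝ) :
    ∑ k ∈ Finset.range (n + 1), grunwaldCoeff n k * (r - k) ^ (n + 1) =
      (n + 1).factorial * (r - n / 2) := by
  set S : ℝ → ℝ := fun r => ∑ k ∈ Finset.range (n + 1), grunwaldCoeff n k * (r - k) ^ (n + 1) -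
    (n + 1).factorial * (r - n / 2) with hS
  have hd : ∀ r, HasDerivAt S 0 r := by
    intro r
    have h1 : HasDerivAt (fun r : ℝ => ∑ k ∈ Finset.range (n + 1),
        grunwaldCoeff n k * (r - k) ^ (n + 1))
        (∑ k ∈ Finset.range (n + 1), grunwaldCoeff n k * ((n + 1 : ℕ) * (r - k) ^ n)) r := by
      refine HasDerivAt.fun_sum fun k _ => HasDerivAt.const_mul _ ?_
      simpa using ((hasDerivAt_id r).sub_const (k : ℝ)).fun_pow (n + 1)
    have h2 : HasDerivAt (fun r : ℝ => ((n + 1).factorial : ℝ) * (r - n / 2))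
        ((n + 1).factorial * 1) r := ((hasDerivAt_id r).sub_const _).const_mul _
    refine (h1.sub h2).congr_deriv ?_
    have : ∑ k ∈ Finset.range (n + 1), grunwaldCoeff n k * ((n + 1 : ℕ) * (r - k) ^ n) =
        (n + 1 : ℕ) * ∑ k ∈ Finset.range (n + 1), grunwaldCoeff n k * (r - k) ^ n := by
      rw [Finset.mul_sum]
      exact Finset.sum_congr rfl fun k _ => by ring
    rw [this, sum_grunwaldCoeff_mul_pow_self, Nat.factorial_succ]
    push_cast
    ring
  have h := is_const_of_deriv_eq_zero (fun r => (hd r).differentiableAt) (fun r => (hd r).deriv)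
    r (n / 2)
  simp only [hS, sum_grunwaldCoeff_mul_half_pow_succ, sub_self, mul_zero] at h
  linarith

theorem grunwaldLeft_natCast (n : ℕ) (r h : ℝ) (f : ℝ → ℝ) (x : ℝ) :
    grunwaldLeft n r h f x =
      1 / h ^ n * ∑ k ∈ Finset.range (n + 1), grunwaldCoeff n k * f (x + (r - k) * h) := by
  rw [grunwaldLeft, Real.rpow_natCast, tsum_eq_sum (s := Finset.range (n + 1))]
  · congr 1
    refine Finset.sum_congr rfl fun k _ => ?_
    congr 2
    ring
  · intro k hk
    rw [grunwaldCoeff_natCast, Nat.choose_eq_zero_of_lt (by simpa using hk)]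
    simp

theorem abs_one_div_pow_mul_sub_le {n j : ℕ} {h S D K : ℝ} (hh : 0 < h)
    (hS : |S - h ^ n * D| ≤ K * |h| ^ (n + j)) : |1 / h ^ n * S - D| ≤ K * h ^ j := by
  have hn : 0 < h ^ n := by positivity
  rw [show 1 / h ^ n * S - D = (S - h ^ n * D) / h ^ n by field_simp, abs_div, abs_of_pos hn,
    div_le_iff₀ hn]
  rw [abs_of_pos hh, pow_add] at hS
  linarith

theorem exists_grunwaldLeft_error_le_natCast {n : ℕ} {p q : ℝ} (hpq : p ≠ q)
    {f : ℝ → ℝ} (hf : ContDiff ℝ ((n + 3 : ℕ) : WithTop ℕ∞) f)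
    (hi : ∀ k : ℕ, k ≤ n + 3 → MeasureTheory.Integrable (iteratedDeriv k f)) :
    ∃ (D : ℝ → ℝ) (C : ℝ), ∀ h : ℝ, 0 < h → ∀ x : ℝ,
      |grunwaldLeft n 0 h f x - D x| ≤ C * h ∧
      |weightOne n p q * grunwaldLeft n p h f x + weightTwo n p q * grunwaldLeft n q h f x - D x|
        ≤ C * h ^ 2 := by
  obtain ⟨M₁, hM₁⟩ := exists_forall_abs_iteratedDeriv_le hf hi (k := n + 1) (by omega)
  obtain ⟨M₂, hM₂⟩ := exists_forall_abs_iteratedDeriv_le hf hi (k := n + 2) (by omega)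
  have hf₁ : ContDiff ℝ ((n + 1 : ℕ) : WithTop ℕ∞) f :=
    hf.of_le (by exact_mod_cast (by omega : n + 1 ≤ n + 3))
  have hf₂ : ContDiff ℝ ((n + 2 : ℕ) : WithTop ℕ∞) f :=
    hf.of_le (by exact_mod_cast (by omega : n + 2 ≤ n + 3))
  set s := Finset.range (n + 1)
  set l₁ := weightOne n p q
  set l₂ := weightTwo n p q
  have hl : l₁ + l₂ = 1 := weightOne_add_weightTwo hpq
  have hl' : l₁ * (p - n / 2) + l₂ * (q - n / 2) = 0 := weightOne_mul_add_weightTwo_mul hpq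
  set K₁ := (∑ i ∈ s, |grunwaldCoeff n i| * |0 - (i : ℝ)| ^ (n + 1)) * M₁
  -- The two shifted stencils are merged into one indexed by `ℕ ⊕ ℕ`: only the combination has a
  -- vanishing moment of order `n + 1`.
  set c : ℕ ⊕ ℕ → ℝ := Sum.elim (fun k => l₁ * grunwaldCoeff n k) (fun k => l₂ * grunwaldCoeff n k)
    with hcdef
  set τ : ℕ ⊕ ℕ → ℝ := Sum.elim (fun k => p - k) (fun k => q - k) with hτ
  set K₂ := (∑ i ∈ s.disjSum s, |c i| * |τ i| ^ (n + 2)) * M₂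
  refine ⟨iteratedDeriv n f, max K₁ K₂, fun h hh x => ⟨?_, ?_⟩⟩
  · have h1 := abs_sum_sub_iteratedDeriv_le s (fun k => grunwaldCoeff n k) (fun k => 0 - (k : ℝ))
      (Nat.lt_succ_self n) (fun j hj => by
        rcases (Nat.lt_succ_iff.1 hj).lt_or_eq with hj | rfl
        · rw [if_neg hj.ne]; exact sum_grunwaldCoeff_mul_pow_of_lt hj 0
        · rw [if_pos rfl]; exact sum_grunwaldCoeff_mul_pow_self j 0) hf₁ hM₁ x h
    rw [grunwaldLeft_natCast]
    have h2 := abs_one_div_pow_mul_sub_le (n := n) (j := 1) hh h1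
    rw [pow_one] at h2
    exact h2.trans (mul_le_mul_of_nonneg_right (le_max_left _ _) hh.le)
  · have h1 := abs_sum_sub_iteratedDeriv_le (s.disjSum s) c τ (n := n) (m := n + 2) (by omega)
      (fun j hj => by
        have hsplit : ∑ i ∈ s.disjSum s, c i * τ i ^ j =
            l₁ * ∑ k ∈ s, grunwaldCoeff n k * (p - k) ^ j +
            l₂ * ∑ k ∈ s, grunwaldCoeff n k * (q - k) ^ j := by
          rw [Finset.sum_disjSum, Finset.mul_sum, Finset.mul_sum]
          simp only [hcdef, hτ, Sum.elim_inl, Sum.elim_inr, mul_assoc]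
        rw [hsplit]
        rcases lt_trichotomy j n with hj' | rfl | hj'
        · rw [if_neg hj'.ne, sum_grunwaldCoeff_mul_pow_of_lt hj',
            sum_grunwaldCoeff_mul_pow_of_lt hj', mul_zero, mul_zero, add_zero]
        · rw [if_pos rfl, sum_grunwaldCoeff_mul_pow_self, sum_grunwaldCoeff_mul_pow_self,
            ← add_mul, hl, one_mul]
        · obtain rfl : j = n + 1 := by omega
          rw [if_neg hj'.ne', sum_grunwaldCoeff_mul_pow_succ, sum_grunwaldCoeff_mul_pow_succ]
          linear_combination ((n + 1).factorial : ℝ) * hl') hf₂ hM₂ x h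
    have h2 := abs_one_div_pow_mul_sub_le hh h1
    rw [Finset.sum_disjSum] at h2
    simp only [hcdef, hτ, Sum.elim_inl, Sum.elim_inr, mul_assoc] at h2
    rw [← Finset.mul_sum, ← Finset.mul_sum] at h2
    rw [grunwaldLeft_natCast, grunwaldLeft_natCast]
    refine le_trans (le_of_eq ?_) (h2.trans ?_)
    · congr 1; ring
    · rw [← mul_assoc]
      refine mul_le_mul_of_nonneg_right ?_ (by positivity)
      refine le_trans (le_of_eq ?_) (le_max_right K₁ K₂)
      simp only [K₂, hcdef, hτ, Finset.sum_disjSum, Sum.elim_inl, Sum.elim_inr]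

/-! ### Global error bounds for the symbol on the imaginary axis. -/

/-- The value `W(e^{-iy}) e^{iry}` on the imaginary axis of the unscaled Grünwald symbol. -/
noncomputable def grunwaldAxisSymbol (α r y : ℝ) : ℂ :=
  grunwaldGen α (Complex.exp (-(y * Complex.I))) * Complex.exp (r * (y * Complex.I))

theorem norm_exp_neg_mul_I_le (y : ℝ) : ‖Complex.exp (-(y * Complex.I))‖ ≤ 1 :=
  norm_exp_neg_le_one (by simp)

theorem norm_exp_mul_mul_I (r y : ℝ) : ‖Complex.exp (r * (y * Complex.I))‖ = 1 := by
  rw [← mul_assoc, ← Complex.ofReal_mul, Complex.norm_exp_ofReal_mul_I]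

theorem norm_grunwaldAxisSymbol_le {α : ℝ} (hα : 0 < α) (r y : ℝ) :
    ‖grunwaldAxisSymbol α r y‖ ≤ ∑' k, |grunwaldCoeff α k| := by
  rw [grunwaldAxisSymbol, norm_mul, norm_exp_mul_mul_I, mul_one]
  exact norm_grunwaldGen_le hα (norm_exp_neg_mul_I_le y)

theorem continuous_grunwaldAxisSymbol {α : ℝ} (hα : 0 < α) (r : ℝ) :
    Continuous (grunwaldAxisSymbol α r) := by
  refine Continuous.mul ?_ (by fun_prop)
  exact (continuousOn_grunwaldGen hα).comp_continuous (by fun_prop)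
    fun y => by simpa using norm_exp_neg_mul_I_le y

theorem grunwaldAxisSymbol_eq {α : ℝ} (r : ℝ) {y : ℝ} (hy : y ≠ 0) :
    grunwaldAxisSymbol α r y =
      ((y : ℂ) * Complex.I) ^ (α : ℂ) * grunwaldSymbol α r (y * Complex.I) := by
  have h0 : ((y : ℂ) * Complex.I) ^ (α : ℂ) ≠ 0 := by
    rw [Complex.cpow_ne_zero_iff]
    left
    simpa using hy
  rw [grunwaldAxisSymbol, grunwaldSymbol]
  field_simp

theorem grunwaldAxisSymbol_zero {α : ℝ} (hα : 0 < α) (r : ℝ) : grunwaldAxisSymbol α r 0 = 0 := by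
  rw [grunwaldAxisSymbol, grunwaldGen_eq hα (norm_exp_neg_mul_I_le 0)]
  simp [hα.ne']

theorem exists_norm_sub_cpow_le {α : ℝ} (hα : 0 < α) {m : ℕ} {S : ℂ → ℂ} {Φ : ℝ → ℂ} {B : ℝ}
    (hS : (fun z => S z - 1) =O[𝓝[{z : ℂ | 0 ≤ z.re ∧ z ≠ 0}] 0] fun z : ℂ => z ^ m)
    (hΦ : ∀ y : ℝ, y ≠ 0 → Φ y = ((y : ℂ) * Complex.I) ^ (α : ℂ) * S (y * Complex.I))
    (hΦ0 : Φ 0 = 0) (hB : ∀ y, ‖Φ y‖ ≤ B) :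
    ∃ C, 0 ≤ C ∧ ∀ y : ℝ, ‖Φ y - ((y : ℂ) * Complex.I) ^ (α : ℂ)‖ ≤ C * (|y| ^ α * |y| ^ m) := by
  have hB0 : 0 ≤ B := (norm_nonneg _).trans (hB 0)
  obtain ⟨c, hc0, hc⟩ := hS.exists_nonneg
  have hc := hc.bound
  rw [eventually_nhdsWithin_iff, Metric.eventually_nhds_iff] at hc
  obtain ⟨ε, hε, hc⟩ := hc
  have hnorm : ∀ y : ℝ, ‖((y : ℂ) * Complex.I) ^ (α : ℂ)‖ = |y| ^ α := by
    intro y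
    rw [Complex.norm_cpow_real]
    simp
  -- `c` serves `|y| < ε`, where the expansion applies. For `|y| ≥ ε` the error is at most `B +
  -- |y|^α`, and the two quotients absorb these two terms.
  refine ⟨max c (B / (ε ^ α * ε ^ m) + 1 / ε ^ m), le_max_of_le_left hc0, fun y => ?_⟩
  rcases eq_or_ne y 0 with rfl | hy
  · rw [hΦ0]
    simp [hα.ne']
  have hy' : 0 < |y| := abs_pos.2 hy
  rcases lt_or_ge |y| ε with hlt | hge
  · have := hc (y := (y : ℂ) * Complex.I) (by simpa using hlt) ⟨by simp, by simpa using hy⟩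
    rw [norm_pow] at this
    have hyI : ‖(y : ℂ) * Complex.I‖ = |y| := by simp
    rw [hyI] at this
    rw [hΦ y hy, show ∀ a b : ℂ, a * b - a = a * (b - 1) by intros; ring, norm_mul, hnorm]
    calc |y| ^ α * ‖S (y * Complex.I) - 1‖ ≤ |y| ^ α * (c * |y| ^ m) := by gcongr
      _ = c * (|y| ^ α * |y| ^ m) := by ring
      _ ≤ _ := by gcongr; exact le_max_left _ _
  · have h1 : ε ^ α * ε ^ m ≤ |y| ^ α * |y| ^ m := by gcongr
    have h2 : ε ^ m ≤ |y| ^ m := by gcongr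
    have h3 : B ≤ B / (ε ^ α * ε ^ m) * (|y| ^ α * |y| ^ m) := by
      rw [div_mul_eq_mul_div, le_div_iff₀ (by positivity)]
      gcongr
    have h4 : |y| ^ α ≤ 1 / ε ^ m * (|y| ^ α * |y| ^ m) := by
      rw [div_mul_eq_mul_div, le_div_iff₀ (by positivity), one_mul]
      gcongr
    calc ‖Φ y - ((y : ℂ) * Complex.I) ^ (α : ℂ)‖ ≤ B + |y| ^ α :=
          (norm_sub_le _ _).trans (add_le_add (hB y) (hnorm y).le)
      _ ≤ (B / (ε ^ α * ε ^ m) + 1 / ε ^ m) * (|y| ^ α * |y| ^ m) := by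
          rw [add_mul]; exact add_le_add h3 h4
      _ ≤ _ := by gcongr; exact le_max_right _ _

theorem exists_norm_grunwaldAxisSymbol_sub_le {α : ℝ} (hα : 0 < α) (r : ℝ) :
    ∃ C, 0 ≤ C ∧ ∀ y : ℝ, ‖grunwaldAxisSymbol α r y - ((y : ℂ) * Complex.I) ^ (α : ℂ)‖ ≤
      C * (|y| ^ α * |y| ^ 1) := by
  refine exists_norm_sub_cpow_le hα (S := grunwaldSymbol α r) ?_
    (fun y hy => grunwaldAxisSymbol_eq r hy) (grunwaldAxisSymbol_zero hα r)
    (norm_grunwaldAxisSymbol_le hα r)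
  have h3 := (grunwaldSymbol_isBigO hα r).of_pow_le nhdsWithin_le_nhds (m := 1) (by norm_num)
  have h1 := (isBigO_refl (fun z : ℂ => z ^ 1) (𝓝[{z : ℂ | 0 ≤ z.re ∧ z ≠ 0}] 0)).const_mul_left
    (r - α / 2 : ℂ)
  have h2 := ((isBigO_refl (fun z : ℂ => z ^ 2)
    (𝓝[{z : ℂ | 0 ≤ z.re ∧ z ≠ 0}] 0)).const_mul_left
    ((r - α / 2) ^ 2 / 2 + α / 24 : ℂ)).of_pow_le nhdsWithin_le_nhds (m := 1) (by norm_num)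
  exact ((h3.add h1).add h2).congr_left fun z => by ring

theorem exists_norm_weighted_grunwaldAxisSymbol_sub_le {α p q : ℝ} (hα : 0 < α) (hpq : p ≠ q) :
    ∃ C, 0 ≤ C ∧ ∀ y : ℝ, ‖weightOne α p q * grunwaldAxisSymbol α p y +
      weightTwo α p q * grunwaldAxisSymbol α q y - ((y : ℂ) * Complex.I) ^ (α : ℂ)‖ ≤
      C * (|y| ^ α * |y| ^ 2) := by
  refine exists_norm_sub_cpow_le hα
    (S := fun z => weightOne α p q * grunwaldSymbol α p z + weightTwo α p q * grunwaldSymbol α q z)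
    (Φ := fun y => weightOne α p q * grunwaldAxisSymbol α p y +
      weightTwo α p q * grunwaldAxisSymbol α q y)
    (B := |weightOne α p q| * (∑' k, |grunwaldCoeff α k|) +
      |weightTwo α p q| * ∑' k, |grunwaldCoeff α k|) ?_ ?_ ?_ ?_
  · have h3 := (weighted_grunwaldSymbol_isBigO hα hpq).of_pow_le nhdsWithin_le_nhds (m := 2)
      (by norm_num)
    have h2 := (isBigO_refl (fun z : ℂ => z ^ 2)
      (𝓝[{z : ℂ | 0 ≤ z.re ∧ z ≠ 0}] 0)).const_mul_left (secondCoeff α p q : ℂ)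
    exact (h3.add h2).congr_left fun z => by ring
  · intro y hy
    simp only [grunwaldAxisSymbol_eq _ hy]
    ring
  · simp [grunwaldAxisSymbol_zero hα]
  · intro y
    refine (norm_add_le _ _).trans (add_le_add ?_ ?_) <;>
    · rw [norm_mul, Complex.norm_real, Real.norm_eq_abs]
      gcongr
      exact norm_grunwaldAxisSymbol_le hα _ y

/-! ### Fourier decay and the multiplier representation. -/

open MeasureTheory FourierTransform

theorem iteratedDeriv_ofReal_comp {N : ℕ} {f : ℝ → ℝ} (hf : ContDiff ℝ (N : WithTop ℕ∞) f)
    {k : ℕ} (hk : k ≤ N) :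
    iteratedDeriv k (fun x => (f x : ℂ)) = fun x => ((iteratedDeriv k f x : ℝ) : ℂ) := by
  induction k with
  | zero => simp
  | succ k ih =>
    rw [iteratedDeriv_succ, ih (by omega)]
    ext x
    have hd : DifferentiableAt ℝ (iteratedDeriv k f) x :=
      hf.differentiable_iteratedDeriv k (by exact_mod_cast hk) x
    rw [iteratedDeriv_succ]
    exact hd.hasDerivAt.ofReal_comp.deriv

theorem norm_fourier_le_integral (F : ℝ → ℂ) (ξ : ℝ) : ‖𝓕 F ξ‖ ≤ ∫ x, ‖F x‖ :=
  VectorFourier.norm_fourierIntegral_le_integral_norm _ _ _ _ _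

theorem continuous_fourier_of_integrable {F : ℝ → ℂ} (hF : Integrable F) : Continuous (𝓕 F) :=
  VectorFourier.fourierIntegral_continuous Real.continuous_fourierChar
    (by exact continuous_inner) hF

theorem exists_norm_fourier_le {N : ℕ} {f : ℝ → ℝ} (hf : ContDiff ℝ (N : WithTop ℕ∞) f)
    (hi : ∀ k ≤ N, Integrable (iteratedDeriv k f)) :
    ∃ C, ∀ ξ, ‖𝓕 (fun x => (f x : ℂ)) ξ‖ * (1 + |ξ|) ^ N ≤ C := by
  set F : ℝ → ℂ := fun x => (f x : ℂ) with hFdef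
  have hF : ContDiff ℝ (N : WithTop ℕ∞) F := Complex.ofRealCLM.contDiff.comp hf
  have hFi : ∀ k ≤ N, Integrable (iteratedDeriv k F) := fun k hk => by
    rw [iteratedDeriv_ofReal_comp hf hk]; exact (hi k hk).ofReal
  have hfour := Real.fourier_iteratedDeriv (N := (N : ℕ∞)) (n := N) (f := F)
    (by exact_mod_cast hF) (fun k hk => hFi k (by exact_mod_cast hk)) le_rfl
  refine ⟨2 ^ (N - 1) * ((∫ x, ‖F x‖) + ∫ x, ‖iteratedDeriv N F x‖), fun ξ => ?_⟩
  have h0 := norm_fourier_le_integral F ξ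
  have h1 : ‖𝓕 F ξ‖ * |ξ| ^ N ≤ ∫ x, ‖iteratedDeriv N F x‖ := by
    refine le_trans ?_ (norm_fourier_le_integral (iteratedDeriv N F) ξ)
    rw [hfour, norm_smul, norm_pow, mul_comm]
    gcongr
    have : ‖2 * Real.pi * Complex.I * ξ‖ = 2 * Real.pi * |ξ| := by
      simp [abs_of_pos Real.pi_pos]
    rw [this]
    exact le_mul_of_one_le_left (abs_nonneg _) (by linarith [Real.pi_gt_three])
  have h2 := add_pow_le zero_le_one (abs_nonneg ξ) N
  rw [one_pow] at h2
  calc ‖𝓕 F ξ‖ * (1 + |ξ|) ^ N ≤ ‖𝓕 F ξ‖ * (2 ^ (N - 1) * (1 + |ξ| ^ N)) := by gcongr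
    _ = 2 ^ (N - 1) * (‖𝓕 F ξ‖ + ‖𝓕 F ξ‖ * |ξ| ^ N) := by ring
    _ ≤ _ := by gcongr

theorem integrable_norm_fourier_mul_rpow {N : ℕ} {f : ℝ → ℝ}
    (hf : ContDiff ℝ (N : WithTop ℕ∞) f) (hi : ∀ k ≤ N, Integrable (iteratedDeriv k f))
    {s : ℝ} (hs : 0 ≤ s) (hsN : s + 1 < N) :
    Integrable fun ξ => ‖𝓕 (fun x => (f x : ℂ)) ξ‖ * |ξ| ^ s := by
  obtain ⟨C, hC⟩ := exists_norm_fourier_le hf hi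
  have hint : Integrable (fun x => (f x : ℂ)) := by
    simpa using (hi 0 (Nat.zero_le _)).ofReal (𝕜 := ℂ)
  have hcont := continuous_fourier_of_integrable hint
  refine Integrable.mono' ((integrable_one_add_norm (E := ℝ) (μ := volume) (r := N - s)
    (by simp; linarith)).const_mul C) ?_ (ae_of_all _ fun ξ => ?_)
  · exact (hcont.norm.mul (continuous_abs.rpow_const fun _ => Or.inr hs)).aestronglyMeasurable
  · have h1 : 0 < 1 + |ξ| := by positivity
    rw [Real.norm_of_nonneg (by positivity), Real.norm_eq_abs, neg_sub, Real.rpow_sub h1,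
      Real.rpow_natCast, ← mul_div_assoc, le_div_iff₀ (by positivity)]
    have h2 : |ξ| ^ s ≤ (1 + |ξ|) ^ s := Real.rpow_le_rpow (abs_nonneg _) (by linarith) hs
    calc ‖𝓕 (fun x => (f x : ℂ)) ξ‖ * |ξ| ^ s * (1 + |ξ|) ^ N
        = ‖𝓕 (fun x => (f x : ℂ)) ξ‖ * (1 + |ξ|) ^ N * |ξ| ^ s := by ring
      _ ≤ C * (1 + |ξ|) ^ s := mul_le_mul (hC ξ) h2 (by positivity)
          ((mul_nonneg (norm_nonneg _) (by positivity)).trans (hC ξ))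

theorem eq_integral_exp_mul_fourier {F : ℝ → ℂ} (hc : Continuous F) (hF : Integrable F)
    (hF' : Integrable (𝓕 F)) (x : ℝ) :
    F x = ∫ ξ : ℝ, Complex.exp ((2 * Real.pi * ξ * x : ℝ) * Complex.I) * 𝓕 F ξ := by
  conv_lhs => rw [← hc.fourierInv_fourier_eq hF hF']
  rw [Real.fourierInv_eq']
  congr 1
  ext ξ
  simp only [smul_eq_mul, RCLike.inner_apply, conj_trivial]
  congr 4
  ring

/-- Fourier inversion is applied to each sampled value; absolute summability of the coefficients and
integrability of the transform allow sum and integral to be exchanged. -/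
theorem ofReal_grunwaldLeft_eq_integral {α : ℝ} (hα : 0 < α) {f : ℝ → ℝ} (hc : Continuous f)
    (hF : Integrable fun x => (f x : ℂ)) (hF' : Integrable (𝓕 fun x => (f x : ℂ))) (r h x : ℝ) :
    (grunwaldLeft α r h f x : ℂ) =
      ∫ ξ : ℝ, Complex.exp ((2 * Real.pi * ξ * x : ℝ) * Complex.I) * 𝓕 (fun x => (f x : ℂ)) ξ *
        ((1 / h ^ α : ℝ) * grunwaldAxisSymbol α r (2 * Real.pi * ξ * h)) := by
  set F : ℝ → ℂ := fun x => (f x : ℂ) with hFdef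
  set T : ℕ → ℝ → ℂ := fun k ξ => (grunwaldCoeff α k : ℂ) *
    (Complex.exp ((2 * Real.pi * ξ * (x - (k - r) * h) : ℝ) * Complex.I) * 𝓕 F ξ) with hT
  have hTi : ∀ k, Integrable (T k) := by
    intro k
    refine Integrable.const_mul ?_ _
    refine hF'.bdd_mul (c := 1) ?_ (ae_of_all _ fun ξ => ?_)
    · exact Continuous.aestronglyMeasurable (by fun_prop)
    · rw [Complex.norm_exp_ofReal_mul_I]
  have hTn : ∀ k, ∫ ξ, ‖T k ξ‖ = |grunwaldCoeff α k| * ∫ ξ, ‖𝓕 F ξ‖ := by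
    intro k
    rw [← integral_const_mul]
    congr 1
    ext ξ
    rw [hT]
    simp only [norm_mul, Complex.norm_exp_ofReal_mul_I, Complex.norm_real, Real.norm_eq_abs,
      one_mul]
  have hsum := hasSum_integral_of_summable_integral_norm hTi
    (by simp_rw [hTn]; exact (summable_abs_grunwaldCoeff hα).mul_right _)
  have hL : (grunwaldLeft α r h f x : ℂ) = (1 / h ^ α : ℝ) * ∑' k, ∫ ξ, T k ξ := by
    rw [grunwaldLeft, Complex.ofReal_mul, Complex.ofReal_tsum]
    congr 2
    ext k
    rw [Complex.ofReal_mul, hT]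
    simp only
    rw [integral_const_mul, ← eq_integral_exp_mul_fourier (by fun_prop) hF hF']
  rw [hL, hsum.tsum_eq, ← integral_const_mul]
  congr 1
  ext ξ
  rw [grunwaldAxisSymbol, grunwaldGen, hT]
  simp only
  have : ∀ k : ℕ, (grunwaldCoeff α k : ℂ) *
      (Complex.exp ((2 * Real.pi * ξ * (x - (k - r) * h) : ℝ) * Complex.I) * 𝓕 F ξ) =
      ((grunwaldCoeff α k : ℂ) *
        Complex.exp (-((2 * Real.pi * ξ * h : ℝ) * Complex.I)) ^ k) *
      (Complex.exp (r * ((2 * Real.pi * ξ * h : ℝ) * Complex.I)) *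
        Complex.exp ((2 * Real.pi * ξ * x : ℝ) * Complex.I) * 𝓕 F ξ) := by
    intro k
    have : Complex.exp ((2 * Real.pi * ξ * (x - (k - r) * h) : ℝ) * Complex.I) =
        Complex.exp (-((2 * Real.pi * ξ * h : ℝ) * Complex.I)) ^ k *
        (Complex.exp (r * ((2 * Real.pi * ξ * h : ℝ) * Complex.I)) *
        Complex.exp ((2 * Real.pi * ξ * x : ℝ) * Complex.I)) := by
      rw [← Complex.exp_nat_mul, ← Complex.exp_add, ← Complex.exp_add]
      congr 1
      push_cast
      ring
    rw [this]
    ring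
  simp_rw [this]
  rw [tsum_mul_right]
  ring

/-! ### Fourier error estimate for `α < n`, and the combined rates. -/

theorem norm_integral_mul_sub_le {α : ℝ} (hα : 0 < α) {m : ℕ} {Φ : ℝ → ℂ} (hΦc : Continuous Φ)
    {B C : ℝ} (hB : ∀ y, ‖Φ y‖ ≤ B)
    (hC : ∀ y : ℝ, ‖Φ y - ((y : ℂ) * Complex.I) ^ (α : ℂ)‖ ≤ C * (|y| ^ α * |y| ^ m))
    {g : ℝ → ℂ} (hg : Integrable g) (hg0 : Integrable fun ξ => ‖g ξ‖ * |ξ| ^ α)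
    (hgm : Integrable fun ξ => ‖g ξ‖ * |ξ| ^ (α + m)) {h : ℝ} (hh : 0 < h) (x : ℝ) :
    ‖(∫ ξ : ℝ, Complex.exp ((2 * Real.pi * ξ * x : ℝ) * Complex.I) * g ξ *
        ((1 / h ^ α : ℝ) * Φ (2 * Real.pi * ξ * h))) -
      ∫ ξ : ℝ, Complex.exp ((2 * Real.pi * ξ * x : ℝ) * Complex.I) * g ξ *
        ((2 * Real.pi * ξ : ℝ) * Complex.I) ^ (α : ℂ)‖ ≤
      (C * ((2 * Real.pi) ^ (α + m) * ∫ ξ, ‖g ξ‖ * |ξ| ^ (α + m))) * h ^ m := by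
  have hπ : 0 < 2 * Real.pi := by positivity
  have he : ∀ ξ : ℝ, ‖Complex.exp ((2 * Real.pi * ξ * x : ℝ) * Complex.I)‖ = 1 := fun ξ =>
    Complex.norm_exp_ofReal_mul_I _
  have hem : Continuous fun ξ : ℝ => Complex.exp ((2 * Real.pi * ξ * x : ℝ) * Complex.I) := by
    fun_prop
  have heg : Integrable fun ξ : ℝ =>
      Complex.exp ((2 * Real.pi * ξ * x : ℝ) * Complex.I) * g ξ :=
    hg.bdd_mul (c := 1) hem.aestronglyMeasurable (ae_of_all _ fun ξ => (he ξ).le)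
  have hi1 : Integrable fun ξ : ℝ => Complex.exp ((2 * Real.pi * ξ * x : ℝ) * Complex.I) * g ξ *
      ((1 / h ^ α : ℝ) * Φ (2 * Real.pi * ξ * h)) := by
    refine heg.mul_bdd (c := ‖((1 / h ^ α : ℝ) : ℂ)‖ * B)
      (Continuous.aestronglyMeasurable (by fun_prop)) (ae_of_all _ fun ξ => ?_)
    rw [norm_mul]
    gcongr
    exact hB _
  have hi2 : Integrable fun ξ : ℝ => Complex.exp ((2 * Real.pi * ξ * x : ℝ) * Complex.I) * g ξ *
      ((2 * Real.pi * ξ : ℝ) * Complex.I) ^ (α : ℂ) := by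
    refine Integrable.mono' (hg0.const_mul ((2 * Real.pi) ^ α)) ?_ (ae_of_all _ fun ξ => ?_)
    · refine heg.aestronglyMeasurable.mul (Measurable.aestronglyMeasurable ?_)
      fun_prop
    · rw [norm_mul, norm_mul, he, one_mul, Complex.norm_cpow_real, norm_mul, Complex.norm_I,
        mul_one, Complex.norm_real, Real.norm_eq_abs, abs_mul, abs_of_pos hπ,
        Real.mul_rpow hπ.le (abs_nonneg _)]
      exact le_of_eq (by ring)
  rw [← integral_sub hi1 hi2]
  refine (norm_integral_le_of_norm_le
    (hgm.const_mul (C * (2 * Real.pi) ^ (α + m) * h ^ m)) (ae_of_all _ fun ξ => ?_)).trans ?_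
  · rw [← mul_sub, norm_mul, norm_mul, he, one_mul]
    have hhα : (0 : ℝ) < h ^ α := Real.rpow_pos_of_pos hh α
    -- The principal power is homogeneous under positive scaling, so `h^{-α}` cancels and the bound
    -- `hC` leaves exactly `h^m`.
    have hpow : (((2 * Real.pi * ξ * h : ℝ) : ℂ) * Complex.I) ^ (α : ℂ) =
        ((h ^ α : ℝ) : ℂ) * ((2 * Real.pi * ξ : ℝ) * Complex.I) ^ (α : ℂ) := by
      rw [Complex.ofReal_cpow hh.le, show (((2 * Real.pi * ξ * h : ℝ) : ℂ) * Complex.I) =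
        (h : ℂ) * ((2 * Real.pi * ξ : ℝ) * Complex.I) by push_cast; ring]
      rcases eq_or_ne ξ 0 with rfl | hξ
      · simp [hα.ne']
      have hz : ((2 * Real.pi * ξ : ℝ) : ℂ) * Complex.I ≠ 0 := by
        simpa [Real.pi_ne_zero] using hξ
      rw [Complex.cpow_def_of_ne_zero (mul_ne_zero (by exact_mod_cast hh.ne') hz),
        Complex.log_ofReal_mul hh hz, Complex.cpow_def_of_ne_zero (by exact_mod_cast hh.ne'),
        Complex.cpow_def_of_ne_zero hz, ← Complex.exp_add, Complex.ofReal_log hh.le]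
      congr 1
      ring
    have h1 := hC (2 * Real.pi * ξ * h)
    rw [hpow] at h1
    have h2 : (1 / h ^ α : ℝ) * Φ (2 * Real.pi * ξ * h) -
        ((2 * Real.pi * ξ : ℝ) * Complex.I) ^ (α : ℂ) = (1 / h ^ α : ℝ) *
        (Φ (2 * Real.pi * ξ * h) -
          ((h ^ α : ℝ) : ℂ) * ((2 * Real.pi * ξ : ℝ) * Complex.I) ^ (α : ℂ)) := by
      have : ((1 / h ^ α : ℝ) : ℂ) * ((h ^ α : ℝ) : ℂ) = 1 := by
        rw [← Complex.ofReal_mul, one_div_mul_cancel hhα.ne', Complex.ofReal_one]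
      linear_combination (((2 * Real.pi * ξ : ℝ) : ℂ) * Complex.I) ^ (α : ℂ) * this
    rw [h2, norm_mul, Complex.norm_real, Real.norm_of_nonneg (by positivity)]
    rw [← Real.rpow_natCast, ← Real.rpow_add' (abs_nonneg _) (by positivity), abs_mul, abs_mul,
      abs_of_pos hπ, abs_of_pos hh, Real.mul_rpow (by positivity) hh.le,
      Real.mul_rpow hπ.le (abs_nonneg _), Real.rpow_add hh, Real.rpow_natCast] at h1
    calc ‖g ξ‖ * (1 / h ^ α * ‖Φ (2 * Real.pi * ξ * h) -
          ((h ^ α : ℝ) : ℂ) * ((2 * Real.pi * ξ : ℝ) * Complex.I) ^ (α : ℂ)‖)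
        ≤ ‖g ξ‖ * (1 / h ^ α *
          (C * ((2 * Real.pi) ^ (α + m) * |ξ| ^ (α + m) * (h ^ α * h ^ m)))) := by gcongr
      _ = _ := by field_simp
  · rw [integral_const_mul]
    exact le_of_eq (by ring)

theorem abs_sub_re_le_of_norm_le {a c : ℝ} {z w : ℂ} (ha : (a : ℂ) = z) (h : ‖z - w‖ ≤ c) :
    |a - w.re| ≤ c := by
  refine le_trans ?_ h
  rw [← ha]
  simpa using Complex.abs_re_le_norm ((a : ℂ) - w)

theorem exists_grunwaldLeft_error_le_of_lt {n : ℕ} {α p q : ℝ} (hα : 0 < α) (hαn : α < n)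
    (hpq : p ≠ q) {f : ℝ → ℝ} (hf : ContDiff ℝ ((n + 3 : ℕ) : WithTop ℕ∞) f)
    (hi : ∀ k : ℕ, k ≤ n + 3 → Integrable (iteratedDeriv k f)) :
    ∃ (D : ℝ → ℝ) (C : ℝ), ∀ h : ℝ, 0 < h → ∀ x : ℝ,
      |grunwaldLeft α 0 h f x - D x| ≤ C * h ∧
      |weightOne α p q * grunwaldLeft α p h f x + weightTwo α p q * grunwaldLeft α q h f x - D x|
        ≤ C * h ^ 2 := by
  set F : ℝ → ℂ := fun x => (f x : ℂ) with hFdef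
  have hF : Integrable F := by
    simpa using (hi 0 (Nat.zero_le _)).ofReal (𝕜 := ℂ)
  -- Strictness of `α < n` enters here: `s + 1 ≤ α + 3 < n + 3`.
  have hw : ∀ s : ℝ, 0 ≤ s → s ≤ α + 2 → Integrable fun ξ => ‖𝓕 F ξ‖ * |ξ| ^ s := fun s hs hs' =>
    integrable_norm_fourier_mul_rpow hf hi hs (by push_cast; linarith)
  have hF' : Integrable (𝓕 F) := by
    rw [← integrable_norm_iff (continuous_fourier_of_integrable hF).aestronglyMeasurable]
    simpa using hw 0 le_rfl (by linarith)
  have hL := ofReal_grunwaldLeft_eq_integral hα hf.continuous hF hF'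
  obtain ⟨C₁, -, hC₁⟩ := exists_norm_grunwaldAxisSymbol_sub_le hα 0
  obtain ⟨C₂, -, hC₂⟩ := exists_norm_weighted_grunwaldAxisSymbol_sub_le hα hpq
  have hΦc := continuous_grunwaldAxisSymbol hα
  have hΦb := norm_grunwaldAxisSymbol_le hα
  set l₁ := weightOne α p q
  set l₂ := weightTwo α p q
  set A := ∑' k, |grunwaldCoeff α k|
  have hint : ∀ r h x, 0 < h → Integrable fun ξ : ℝ =>
      Complex.exp ((2 * Real.pi * ξ * x : ℝ) * Complex.I) * 𝓕 F ξ *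
        ((1 / h ^ α : ℝ) * grunwaldAxisSymbol α r (2 * Real.pi * ξ * h)) := by
    intro r h x hh
    refine (hF'.bdd_mul (c := 1) (Continuous.aestronglyMeasurable (by fun_prop))
      (ae_of_all _ fun ξ => (Complex.norm_exp_ofReal_mul_I _).le)).mul_bdd
      (c := ‖((1 / h ^ α : ℝ) : ℂ)‖ * A)
      (Continuous.aestronglyMeasurable (by have := hΦc r; fun_prop)) (ae_of_all _ fun ξ => ?_)
    rw [norm_mul]
    gcongr
    exact hΦb _ _
  set K₁ := C₁ * ((2 * Real.pi) ^ (α + (1 : ℕ)) * ∫ ξ, ‖𝓕 F ξ‖ * |ξ| ^ (α + (1 : ℕ)))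
  set K₂ := C₂ * ((2 * Real.pi) ^ (α + (2 : ℕ)) * ∫ ξ, ‖𝓕 F ξ‖ * |ξ| ^ (α + (2 : ℕ)))
  refine ⟨fun x => (∫ ξ : ℝ, Complex.exp ((2 * Real.pi * ξ * x : ℝ) * Complex.I) * 𝓕 F ξ *
    ((2 * Real.pi * ξ : ℝ) * Complex.I) ^ (α : ℂ)).re, max K₁ K₂, fun h hh x => ⟨?_, ?_⟩⟩
  · have h1 := norm_integral_mul_sub_le hα (hΦc 0) (hΦb 0) hC₁ hF' (hw α hα.le (by linarith))
      (hw _ (by positivity) (by norm_num)) hh x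
    refine (abs_sub_re_le_of_norm_le (hL 0 h x) h1).trans ?_
    rw [pow_one]
    exact mul_le_mul_of_nonneg_right (le_max_left _ _) hh.le
  · have h1 := norm_integral_mul_sub_le hα
      (Φ := fun y => l₁ * grunwaldAxisSymbol α p y + l₂ * grunwaldAxisSymbol α q y)
      (B := |l₁| * A + |l₂| * A) (by have := hΦc p; have := hΦc q; fun_prop)
      (fun y => by
        refine (norm_add_le _ _).trans (add_le_add ?_ ?_) <;>
        · rw [norm_mul, Complex.norm_real, Real.norm_eq_abs]
          gcongr
          exact hΦb _ y) hC₂ hF' (hw α hα.le (by linarith))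
      (hw _ (by positivity) (by norm_num)) hh x
    refine (abs_sub_re_le_of_norm_le ?_ h1).trans
      (mul_le_mul_of_nonneg_right (le_max_right K₁ K₂) (by positivity))
    push_cast
    rw [hL p h x, hL q h x, ← integral_const_mul, ← integral_const_mul,
      ← integral_add ((hint p h x hh).const_mul _) ((hint q h x hh).const_mul _)]
    congr 1
    ext ξ
    push_cast
    ring

theorem exists_grunwaldLeft_error_le {n : ℕ} {α p q : ℝ} (hα : 0 < α) (hαn : α ≤ n)
    (hpq : p ≠ q) {f : ℝ → ℝ} (hf : ContDiff ℝ ((n + 3 : ℕ) : WithTop ℕ∞) f)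
    (hi : ∀ k : ℕ, k ≤ n + 3 → MeasureTheory.Integrable (iteratedDeriv k f)) :
    ∃ (D : ℝ → ℝ) (C : ℝ), ∀ h : ℝ, 0 < h → ∀ x : ℝ,
      |grunwaldLeft α 0 h f x - D x| ≤ C * h ∧
      |weightOne α p q * grunwaldLeft α p h f x + weightTwo α p q * grunwaldLeft α q h f x - D x|
        ≤ C * h ^ 2 := by
  rcases hαn.lt_or_eq with hlt | rfl
  · exact exists_grunwaldLeft_error_le_of_lt hα hlt hpq hf hi
  · exact exists_grunwaldLeft_error_le_natCast hpq hf hi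

/-! ### Truncated sums. -/

theorem summable_grunwaldCoeff_mul {α : ℝ} (hα : 0 < α) {u : ℕ → ℝ} {M : ℝ}
    (hu : ∀ k, |u k| ≤ M) : Summable fun k => grunwaldCoeff α k * u k := by
  refine .of_norm_bounded ((summable_abs_grunwaldCoeff hα).mul_right M) fun k => ?_
  rw [norm_mul, Real.norm_eq_abs, Real.norm_eq_abs]
  gcongr
  exact hu k

/-- Rounding `(x - a)/h` down loses less than one step, so an omitted node may still lie in `[a, a +
h)`. For shift `0` the node index is itself an integer and nothing is lost. -/
theorem lt_of_not_mem_truncation {a x r h : ℝ} {k : ℕ} (hh : 0 < h)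
    (hk : (⌊(⌊(x - a) / h⌋ : ℝ) + r⌋ + 1).toNat ≤ k) : x - ((k : ℝ) - r) * h < a + h := by
  have h1 : ⌊(⌊(x - a) / h⌋ : ℝ) + r⌋ < (k : ℤ) := by omega
  have h2 : (⌊(x - a) / h⌋ : ℝ) + r < k := by simpa using Int.floor_lt.1 h1
  have h3 := Int.lt_floor_add_one ((x - a) / h)
  have h4 : (x - a) / h < (k - r) + 1 := by linarith
  rw [div_lt_iff₀ hh] at h4
  linarith

theorem grunwaldLeftFrom_zero_eq {α a x h : ℝ} {f : ℝ → ℝ} (hh : 0 < h)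
    (h0 : ∀ y < a, f y = 0) : grunwaldLeftFrom a α 0 h f x = grunwaldLeft α 0 h f x := by
  rw [grunwaldLeftFrom, grunwaldLeft, tsum_eq_sum]
  intro k hk
  have hk' : (⌊(⌊(x - a) / h⌋ : ℝ) + 0⌋ + 1).toNat ≤ k := by simpa using hk
  rw [add_zero, Int.floor_intCast] at hk'
  have h1 : ⌊(x - a) / h⌋ < (k : ℤ) := by omega
  have h2 : (x - a) / h < k := by simpa using Int.floor_lt.1 h1
  rw [div_lt_iff₀ hh] at h2
  rw [h0 _ (by linarith), mul_zero]

/-- Omitted nodes below `a` contribute nothing. At those in `[a, a + h)` the function is at most `M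
h^{n+2}`, because its derivatives through order `n + 1` vanish at `a`. -/
theorem abs_grunwaldLeftFrom_sub_grunwaldLeft_le {n : ℕ} {α a r x h M : ℝ} (hα : 0 < α)
    (hαn : α ≤ n) {f : ℝ → ℝ} (hb : ∃ B, ∀ y, |f y| ≤ B)
    (hf : ContDiff ℝ ((n + 2 : ℕ) : WithTop ℕ∞) f)
    (hM : ∀ y, |iteratedDeriv (n + 2) f y| ≤ M) (hh : 0 < h) (hh1 : h ≤ 1)
    (h0 : ∀ y < a, f y = 0) :
    |grunwaldLeftFrom a α r h f x - grunwaldLeft α r h f x| ≤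
      (∑' k, |grunwaldCoeff α k|) * M * h ^ 2 := by
  obtain ⟨B, hB⟩ := hb
  have hM0 : 0 ≤ M := (abs_nonneg _).trans (hM 0)
  set K := (⌊(⌊(x - a) / h⌋ : ℝ) + r⌋ + 1).toNat with hK
  have hs : Summable fun k : ℕ => grunwaldCoeff α k * f (x - ((k : ℝ) - r) * h) :=
    summable_grunwaldCoeff_mul hα fun k => hB _
  have hsplit := hs.sum_add_tsum_nat_add K
  have htail : ‖∑' i : ℕ, grunwaldCoeff α (i + K) * f (x - (((i + K : ℕ) : ℝ) - r) * h)‖ ≤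
      (∑' k, |grunwaldCoeff α k|) * (M * h ^ (n + 2)) := by
    have hsum := summable_abs_grunwaldCoeff hα
    have hle : ∑' i, |grunwaldCoeff α (i + K)| ≤ ∑' k, |grunwaldCoeff α k| := by
      rw [← hsum.sum_add_tsum_nat_add K]
      exact le_add_of_nonneg_left (Finset.sum_nonneg fun _ _ => abs_nonneg _)
    refine (tsum_of_norm_bounded (((summable_nat_add_iff K).2 hsum).hasSum.mul_right
      (M * h ^ (n + 2))) fun i => ?_).trans (by gcongr)
    rw [norm_mul, Real.norm_eq_abs, Real.norm_eq_abs]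
    refine mul_le_mul_of_nonneg_left ?_ (abs_nonneg _)
    have hlt := lt_of_not_mem_truncation (a := a) (x := x) (r := r) (k := i + K) hh
      (Nat.le_add_left _ _)
    rcases lt_or_ge (x - (((i + K : ℕ) : ℝ) - r) * h) a with hya | hya
    · rw [h0 _ hya, abs_zero]
      positivity
    · refine (abs_le_of_eq_zero_of_lt hf hM h0 _).trans ?_
      rw [abs_of_nonneg (sub_nonneg.2 hya)]
      refine mul_le_mul_of_nonneg_left (pow_le_pow_left₀ (sub_nonneg.2 hya) ?_ _) hM0
      linarith
  have hhα : (0 : ℝ) < h ^ α := Real.rpow_pos_of_pos hh α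
  rw [grunwaldLeftFrom, grunwaldLeft, ← hsplit, ← mul_sub, ← hK, sub_add_cancel_left, abs_mul,
    abs_neg, abs_of_pos (one_div_pos.2 hhα), ← Real.norm_eq_abs]
  -- This is where `h ≤ 1` matters: with `α ≤ n` it gives `h^n ≤ h^α`.
  have hpow : h ^ (n + 2) ≤ h ^ α * h ^ 2 := by
    rw [pow_add, ← Real.rpow_natCast h n]
    exact mul_le_mul_of_nonneg_right (Real.rpow_le_rpow_of_exponent_ge hh hh1 hαn) (by positivity)
  have hA : 0 ≤ ∑' k, |grunwaldCoeff α k| := tsum_nonneg fun _ => abs_nonneg _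
  calc 1 / h ^ α * ‖∑' i : ℕ, grunwaldCoeff α (i + K) * f (x - (((i + K : ℕ) : ℝ) - r) * h)‖
      ≤ 1 / h ^ α * ((∑' k, |grunwaldCoeff α k|) * (M * (h ^ α * h ^ 2))) := by
        gcongr
        exact htail.trans (by gcongr)
    _ = _ := by field_simp

theorem exists_grunwaldLeft_second_order {n : ℕ} {α p q : ℝ} (hα : 0 < α) (hαn : α ≤ n)
    (hpq : p ≠ q) {f : ℝ → ℝ} (hf : ContDiff ℝ ((n + 3 : ℕ) : WithTop ℕ∞) f)
    (hi : ∀ k : ℕ, k ≤ n + 3 → MeasureTheory.Integrable (iteratedDeriv k f)) :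
    ∃ D : ℝ → ℝ, (∀ x, HasLeftGLDeriv α f x (D x)) ∧
      (∀ a x : ℝ, (∀ y < a, f y = 0) → HasLeftGLDerivFrom a α f x (D x)) ∧
      ∃ C : ℝ, ∀ h : ℝ, 0 < h → h ≤ 1 → ∀ x : ℝ,
        |weightOne α p q * grunwaldLeft α p h f x
          + weightTwo α p q * grunwaldLeft α q h f x - D x| ≤ C * h ^ 2 ∧
        (∀ a : ℝ, (∀ y < a, f y = 0) →
          |weightOne α p q * grunwaldLeftFrom a α p h f x
            + weightTwo α p q * grunwaldLeftFrom a α q h f x - D x| ≤ C * h ^ 2) := by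
  obtain ⟨D, C, hDC⟩ := exists_grunwaldLeft_error_le hα hαn hpq hf hi
  obtain ⟨M, hM⟩ := exists_forall_abs_iteratedDeriv_le hf hi (k := n + 2) (by omega)
  have hb : ∃ B, ∀ y, |f y| ≤ B := by
    simpa using exists_forall_abs_iteratedDeriv_le hf hi (k := 0) (by omega)
  have hf₂ : ContDiff ℝ ((n + 2 : ℕ) : WithTop ℕ∞) f :=
    hf.of_le (by exact_mod_cast (by omega : n + 2 ≤ n + 3))
  have hlim : ∀ x, HasLeftGLDeriv α f x (D x) := by
    intro x
    rw [HasLeftGLDeriv, tendsto_iff_norm_sub_tendsto_zero]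
    have h0 : Tendsto (fun h : ℝ => C * h) (𝓝[>] 0) (𝓝 0) := by
      have : Tendsto (fun h : ℝ => C * h) (𝓝 0) (𝓝 (C * 0)) := tendsto_id.const_mul C
      rw [mul_zero] at this
      exact this.mono_left nhdsWithin_le_nhds
    refine squeeze_zero' (Eventually.of_forall fun _ => norm_nonneg _) ?_ h0
    filter_upwards [self_mem_nhdsWithin] with h hh using (hDC h hh x).1
  set A := (∑' k, |grunwaldCoeff α k|) * M with hA
  have hA0 : 0 ≤ A := mul_nonneg (tsum_nonneg fun _ => abs_nonneg _) ((abs_nonneg _).trans (hM 0))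
  set l₁ := weightOne α p q
  set l₂ := weightTwo α p q
  refine ⟨D, hlim, fun a x h0 => ?_, C + (|l₁| + |l₂|) * A, fun h hh hh1 x => ⟨?_, fun a h0 => ?_⟩⟩
  · refine (hlim x).congr' ?_
    filter_upwards [self_mem_nhdsWithin] with h hh
    exact (grunwaldLeftFrom_zero_eq hh h0).symm
  · refine (hDC h hh x).2.trans (mul_le_mul_of_nonneg_right ?_ (by positivity))
    exact le_add_of_nonneg_right (by positivity)
  · have hp := abs_grunwaldLeftFrom_sub_grunwaldLeft_le (r := p) (x := x) hα hαn hb hf₂ hM hh hh1 h0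
    have hq := abs_grunwaldLeftFrom_sub_grunwaldLeft_le (r := q) (x := x) hα hαn hb hf₂ hM hh hh1 h0
    rw [show l₁ * grunwaldLeftFrom a α p h f x + l₂ * grunwaldLeftFrom a α q h f x - D x =
      (l₁ * grunwaldLeft α p h f x + l₂ * grunwaldLeft α q h f x - D x) +
      l₁ * (grunwaldLeftFrom a α p h f x - grunwaldLeft α p h f x) +
      l₂ * (grunwaldLeftFrom a α q h f x - grunwaldLeft α q h f x) by ring]
    refine (abs_add_three _ _ _).trans ?_
    rw [abs_mul l₁, abs_mul l₂]
    calc _ ≤ C * h ^ 2 + |l₁| * (A * h ^ 2) + |l₂| * (A * h ^ 2) := by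
          gcongr
          exact (hDC h hh x).2
      _ = _ := by ring

/-! ### Right operators by reflection, and assembly. -/

theorem grunwaldRight_eq_grunwaldLeft_comp_neg (α r h : ℝ) (f : ℝ → ℝ) (x : ℝ) :
    grunwaldRight α r h f x = grunwaldLeft α r h (fun y => f (-y)) (-x) := by
  rw [grunwaldRight, grunwaldLeft]
  congr 2
  ext k
  congr 2
  ring

theorem grunwaldRightTo_eq_grunwaldLeftFrom_comp_neg (b α r h : ℝ) (f : ℝ → ℝ) (x : ℝ) :
    grunwaldRightTo b α r h f x = grunwaldLeftFrom (-b) α r h (fun y => f (-y)) (-x) := by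
  rw [grunwaldRightTo, grunwaldLeftFrom, show -x - -b = b - x by ring]
  congr 1
  refine Finset.sum_congr rfl fun k _ => ?_
  congr 2
  ring

theorem exists_grunwaldRight_second_order {n : ℕ} {α p q : ℝ} (hα : 0 < α) (hαn : α ≤ n)
    (hpq : p ≠ q) {f : ℝ → ℝ} (hf : ContDiff ℝ ((n + 3 : ℕ) : WithTop ℕ∞) f)
    (hi : ∀ k : ℕ, k ≤ n + 3 → MeasureTheory.Integrable (iteratedDeriv k f)) :
    ∃ D : ℝ → ℝ, (∀ x, HasRightGLDeriv α f x (D x)) ∧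
      (∀ b x : ℝ, (∀ y > b, f y = 0) → HasRightGLDerivTo b α f x (D x)) ∧
      ∃ C : ℝ, ∀ h : ℝ, 0 < h → h ≤ 1 → ∀ x : ℝ,
        |weightOne α p q * grunwaldRight α p h f x
          + weightTwo α p q * grunwaldRight α q h f x - D x| ≤ C * h ^ 2 ∧
        (∀ b : ℝ, (∀ y > b, f y = 0) →
          |weightOne α p q * grunwaldRightTo b α p h f x
            + weightTwo α p q * grunwaldRightTo b α q h f x - D x| ≤ C * h ^ 2) := by
  obtain ⟨D, hD, hDf, C, hC⟩ := exists_grunwaldLeft_second_order (f := fun y => f (-y)) hα hαn hpq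
    (hf.comp contDiff_neg) (fun k hk => by
      have : iteratedDeriv k (fun y => f (-y)) = fun y => (-1 : ℝ) ^ k • iteratedDeriv k f (-y) :=
        funext fun y => iteratedDeriv_comp_neg k f y
      rw [this]
      exact (hi k hk).comp_neg.smul ((-1 : ℝ) ^ k))
  have hneg : ∀ b : ℝ, (∀ y > b, f y = 0) → ∀ y < -b, f (-y) = 0 := fun b hb y hy =>
    hb _ (by linarith)
  refine ⟨fun x => D (-x), fun x => ?_, fun b x hb => ?_, C, fun h hh hh1 x => ?_⟩
  · simpa only [HasLeftGLDeriv, HasRightGLDeriv, grunwaldRight_eq_grunwaldLeft_comp_neg] using hD (-x)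
  · simpa only [HasLeftGLDerivFrom, HasRightGLDerivTo, grunwaldRightTo_eq_grunwaldLeftFrom_comp_neg] using
      hDf (-b) (-x) (hneg b hb)
  · simp only [grunwaldRight_eq_grunwaldLeft_comp_neg,
      grunwaldRightTo_eq_grunwaldLeftFrom_comp_neg]
    exact ⟨(hC h hh hh1 (-x)).1, fun b hb => (hC h hh hh1 (-x)).2 (-b) (hneg b hb)⟩

theorem mainTheorem12 (n : ℕ) (α : ℝ) (hα : 0 < α) (hn : (n : ℝ) - 1 < α) (hn' : α ≤ n) :
    (∀ p q : ℝ, p ≠ q →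
      -- the weights sum to one
      weightOne α p q + weightTwo α p q = 1 ∧
      -- second order accuracy
      (∀ f : ℝ → ℝ, ContDiff ℝ ((n + 3 : ℕ) : WithTop ℕ∞) f →
        (∀ k : ℕ, k ≤ n + 3 → MeasureTheory.Integrable (iteratedDeriv k f)) →
        (∀ r h x : ℝ,
          Summable (fun k : ℕ => grunwaldCoeff α k * f (x - ((k : ℝ) - r) * h)) ∧
          Summable (fun k : ℕ => grunwaldCoeff α k * f (x + ((k : ℝ) - r) * h))) ∧
        ∃ DL DR : ℝ → ℝ,
          (∀ x : ℝ, HasLeftGLDeriv α f x (DL x) ∧ HasRightGLDeriv α f x (DR x)) ∧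
          (∀ a x : ℝ, a < x → (∀ y < a, f y = 0) → HasLeftGLDerivFrom a α f x (DL x)) ∧
          (∀ b x : ℝ, x < b → (∀ y > b, f y = 0) → HasRightGLDerivTo b α f x (DR x)) ∧
          ∃ C : ℝ, ∀ h : ℝ, 0 < h → h ≤ 1 → ∀ x : ℝ,
            |weightOne α p q * grunwaldLeft α p h f x
              + weightTwo α p q * grunwaldLeft α q h f x - DL x| ≤ C * h ^ 2 ∧
            |weightOne α p q * grunwaldRight α p h f x
              + weightTwo α p q * grunwaldRight α q h f x - DR x| ≤ C * h ^ 2 ∧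
            (∀ a : ℝ, a < x → (∀ y < a, f y = 0) →
              |weightOne α p q * grunwaldLeftFrom a α p h f x
                + weightTwo α p q * grunwaldLeftFrom a α q h f x - DL x| ≤ C * h ^ 2) ∧
            (∀ b : ℝ, x < b → (∀ y > b, f y = 0) →
              |weightOne α p q * grunwaldRightTo b α p h f x
                + weightTwo α p q * grunwaldRightTo b α q h f x - DR x| ≤ C * h ^ 2)) ∧
      -- the series defining the symbol converges, and its expansion at zero
      (∀ z : ℂ, 0 ≤ z.re →
        Summable (fun k : ℕ => (grunwaldCoeff α k : ℂ) * Complex.exp (-z) ^ k)) ∧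
      (fun z : ℂ => weightOne α p q * grunwaldSymbol α p z + weightTwo α p q * grunwaldSymbol α q z
          - (1 + secondCoeff α p q * z ^ 2))
        =O[𝓝[{z : ℂ | 0 ≤ z.re ∧ z ≠ 0}] 0] (fun z : ℂ => z ^ 3) ∧
      (secondCoeff α p q = 0 ↔ 3 * (2 * p - α) * (2 * q - α) = α)) ∧
    -- the second coefficient does not vanish for integer shifts
    (α ≤ 2 → ∀ p q : ℤ, p ≠ q → ¬ (p = 1 ∧ 2 ≤ q) → ¬ (q = 1 ∧ 2 ≤ p) →
      secondCoeff α p q ≠ 0) := by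
  refine ⟨fun p q hpq => ⟨weightOne_add_weightTwo hpq, fun f hf hi => ⟨fun r h x => ?_, ?_⟩,
    fun z hz => summable_grunwaldCoeff_mul_pow hα (norm_exp_neg_le_one hz),
    weighted_grunwaldSymbol_isBigO hα hpq, secondCoeff_eq_zero_iff α p q⟩,
    fun hα2 p q hpq h1 h2 => secondCoeff_ne_zero hα hα2 hpq h1 h2⟩
  · obtain ⟨B, hB⟩ := exists_forall_abs_iteratedDeriv_le hf hi (k := 0) (by omega)
    simp only [iteratedDeriv_zero] at hB
    exact ⟨summable_grunwaldCoeff_mul hα fun k => hB _,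
      summable_grunwaldCoeff_mul hα fun k => hB _⟩
  · obtain ⟨DL, hL, hLf, CL, hCL⟩ := exists_grunwaldLeft_second_order hα hn' hpq hf hi
    obtain ⟨DR, hR, hRt, CR, hCR⟩ := exists_grunwaldRight_second_order hα hn' hpq hf hi
    refine ⟨DL, DR, fun x => ⟨hL x, hR x⟩, fun a x _ h0 => hLf a x h0, fun b x _ h0 => hRt b x h0,
      max CL CR, fun h hh hh1 x => ?_⟩
    have hl : CL * h ^ 2 ≤ max CL CR * h ^ 2 := by gcongr; exact le_max_left _ _
    have hr : CR * h ^ 2 ≤ max CL CR * h ^ 2 := by gcongr; exact le_max_right _ _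
    exact ⟨(hCL h hh hh1 x).1.trans hl, (hCR h hh hh1 x).1.trans hr,
      fun a _ h0 => ((hCL h hh hh1 x).2 a h0).trans hl,
      fun b _ h0 => ((hCR h hh hh1 x).2 b h0).trans hr⟩
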